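/- **Setting.** Let $(\mathcal X,d)$ be a metric space carrying a $\sigma$-algebra for which $d:\mathcal X\times\mathcal X\to\mathbb R$ is measurable with respect to the product $\sigma$-algebra (for instance a separable metric space with its Borel sets), let $\mu$ be a probability distribution on $\mathcal X$, and let $l:\mathcal X\to\{-1,1\}$ be a measurable labeling function. For a finite non-empty set $\tilde S\subset\mathcal X$, a *weight assignment* for $\tilde S$ is a function $w:\mathcal X\to(0,\infty)$ with $w=1$ outside $\tilde S$. The *weighted nearest neighbor (WNN) classifier* of $(\tilde S,w)$ is $$h_{(\tilde S,w)}(x)=l\Big(\operatorname*{arg\,min}_{y\in\tilde S}\frac{d(y,x)}{w(y)\,w(x)}\Big),\qquad x\in\mathcal X ,$$ where ties are broken in favor of the first point with respect to some linear order (the bounds below hold simultaneously for all such orders). Its error is $\mathrm{err}(h)=\mu\{x: h(x)\ne l(x)\}$. Given an i.i.d. sample $x_1,\dots,x_n\sim\mu$, put $S=\{(x_1,l(x_1)),\dots,(x_n,l(x_n))\}$; $h$ is *consistent* on $S$ if $h(x_i)=l(x_i)$ for all $i$. We write $\tilde S\subset S$ if all the points of $\tilde S$ are among $x_1,\dots,x_n$.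 A *reconstruction function* $\mathcal R$ maps, for every $m$, each pair $(S',W')$ of ordered lists of $m$ labeled points to a classifier $\mathcal R(S',W'):\mathcal X\to\{-1,1\}$, such that $\mathcal R(S',W')(x)$ depends measurably on $(S',W',x)$. It is *permutation invariant* if $\mathcal R(\sigma_1(S'),\sigma_2(W'))=\mathcal R(S',W')$ for all permutations $\sigma_1,\sigma_2$ of the entries of the two lists. The classifier $h_{(\tilde S,w)}$ is *reconstructed by $\mathcal R$ from $S$* if $h_{(\tilde S,w)}=\mathcal R(S',W')$ for some lists $S',W'$ of length $|\tilde S|$ with all entries in $S$. **Theorem.** Let $n\in\mathbb N$ and $0<\delta<1$. 1. With probability at least $1-\delta$ over the sample $S$, the following holds for every non-empty $\tilde S\subset S$ with $|\tilde S|<n$ and every weight assignment $w$ for $\tilde S$: if $h_{(\tilde S,w)}$ is consistent on $S$, then $$\mathrm{err}(h_{(\tilde S,w)})\le\frac{2}{n-|\tilde S|}\Big(|\tilde S|\log (2n)+\log\frac n\delta\Big).$$ 2. Let $\mathcal R$ be a permutation invariant reconstruction function. With probability at least $1-\delta$ over the sample $S$, the following holds for every non-empty $\tilde S\subset S$ with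 $|\tilde S|<n$ and every weight assignment $w$ for $\tilde S$: if $h_{(\tilde S,w)}$ is consistent on $S$ and is reconstructed by $\mathcal R$ from $S$, then $$\mathrm{err}(h_{(\tilde S,w)})\le\frac{2}{n-|\tilde S|}\Big(|\tilde S|\log\frac{2en}{|\tilde S|}+\log\frac n\delta\Big).$$ -/

import Mathlib

namespace WNN

/-- The weighted distance `d(x, x') / (w(x) w(x'))`. -/
noncomputable def weightedDist {X : Type*} [MetricSpace X] (w : X → ℝ) (x x' : X) : ℝ :=
  dist x x' / (w x * w x')

/-- `w` is a weight assignment for `T`: it is positive, and equal to `1` outside of `T`. -/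
def IsWeightAssignment {X : Type*} (T : Finset X) (w : X → ℝ) : Prop :=
  (∀ x, 0 < w x) ∧ ∀ x, x ∉ T → w x = 1

open Classical in
/-- The set of all weighted distance nearest neighbors of `x` in `T`. -/
noncomputable def nearest {X : Type*} [MetricSpace X] (T : Finset X) (w : X → ℝ) (x : X) :
    Finset X :=
  T.filter fun y => ∀ z ∈ T, weightedDist w y x ≤ weightedDist w z x

open Classical in
/-- The classifier of the pair `(T, w)`: the label of the weighted distance nearest neighbor of `x`
in `T`, where ties are decided in favor of the point that comes first in the order `r`.
Labels are elements of `ℤˣ = {1, -1}`. The value for `T = ∅` has no meaning. -/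
noncomputable def classifier {X : Type*} [MetricSpace X] (l : X → ℤˣ) (r : LinearOrder X)
    (T : Finset X) (w : X → ℝ) (x : X) : ℤˣ :=
  if h : (nearest T w x).Nonempty then l (@Finset.min' X r (nearest T w x) h) else 1

/-- The error of the classifier `h` under the distribution `μ` and the labeling `l`. -/
noncomputable def err {X : Type*} [MeasurableSpace X] (μ : MeasureTheory.Measure X) (l : X → ℤˣ)
    (h : X → ℤˣ) : ℝ :=
  μ.real {z | h z ≠ l z}

/-- `h` classifies all the points of the sample `x` correctly. -/
def Consistent {X : Type*} {n : ℕ} (l : X → ℤˣ) (x : Fin n → X) (h : X → ℤˣ) : Prop :=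
  ∀ i, h (x i) = l (x i)

/-- The labeled sample of the points `x`, as a set of point-label pairs. -/
def labeledSample {X : Type*} {n : ℕ} (l : X → ℤˣ) (x : Fin n → X) : Set (X × ℤˣ) :=
  Set.range fun i => (x i, l (x i))

/-- A reconstruction function turns two ordered lists of `m` labeled points each into a classifier,
for every `m`. -/
abbrev Reconstruction (X : Type*) : Type _ :=
  (m : ℕ) → (Fin m → X × ℤˣ) → (Fin m → X × ℤˣ) → X → ℤˣ

namespace Reconstruction

/-- The label assigned to a point depends measurably on the two lists and on the point. -/
def IsMeasurable {X : Type*} [MeasurableSpace X] (R : Reconstruction X) : Prop :=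
  ∀ m, Measurable fun p : (Fin m → X × ℤˣ) × (Fin m → X × ℤˣ) × X => R m p.1 p.2.1 p.2.2

/-- The result does not depend on the order of the points in either of the two lists. -/
def PermutationInvariant {X : Type*} (R : Reconstruction X) : Prop :=
  ∀ (m : ℕ) (s t : Fin m → X × ℤˣ) (σ₁ σ₂ : Equiv.Perm (Fin m)),
    R m (s ∘ σ₁) (t ∘ σ₂) = R m s t

/-- `R` reconstructs `h` from two lists of `m` points each of the labeled sample `x`. -/
def Reconstructs {X : Type*} {n : ℕ} (R : Reconstruction X) (l : X → ℤˣ) (x : Fin n → X) (m : ℕ)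
    (h : X → ℤˣ) : Prop :=
  ∃ s t : Fin m → X × ℤˣ,
    (∀ k, s k ∈ labeledSample l x) ∧ (∀ k, t k ∈ labeledSample l x) ∧ R m s t = h

end Reconstruction

end WNN

/-!
Both bounds are union bounds over the possible descriptions of the classifier by sample points.
Once the points that a description uses are fixed, the other ones are still independent of them
(`measure_exists_avoid_compl_le`), and a classifier of error above `ε` is consistent with `N` of
them only with probability at most `exp (-ε * N)`. The size `m` of `T` gets the share `δ / n` of
the probability of failure (`exists_measurableSet_forall_notMem`), and only the case `ε < 1`
matters, as an error is at most `1`; this forces `n` to be large compared with `m`.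

With a permutation invariant reconstruction function, the classifier is one of the
`((n + m - 1).choose m) ^ 2` classifiers obtained from two multisets of `m` sample points, and at
least `n - 2 * m` points are left.

Without one, the `n ^ m` tuples of sites leave a continuum of weights, whose classifiers have to be
controlled simultaneously (`measure_exists_avoid_le`). Join `c` independent ghost points to each of
the `N = n - m` remaining sample points, and consider the traces of the error regions on
these `(c + 1) * N` points. A trace without sample points gets the weight `((c + 1) / c) ^ k`, where
`k` is its number of ghost points. If some error region of measure at least `ε` contains no
sample point, then the conditional expectation of the total weight is at least `(1 + ε / c) ^ (c * N)`. On the other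
hand, the sample point of a block is exchangeable with its ghost points, and averaging over these
exchanges shows that the expectation of the total weight is at most the largest possible number of
traces. As to this number, the assignment of points to their weighted nearest sites is determined
by the number of points that each site receives (`firstMin_mul_eq_of_map_eq`), so there are at most
as many traces as multisets of size `(c + 1) * N` of the `m` sites. The choice `c = ⌈log (2 * n)⌉`
makes `(1 + ε / c) ^ (c * N)` close enough to `exp (ε * N)`, while the number of traces remains
small (`union_bound_weights`).

Restricting to rational weights makes all events measurable. This is no loss, since every
classifier is a pointwise limit of such classifiers (`exists_rat_tupleClassifier`). The order that
decides ties is taken care of by the tuples of sites, which are enumerated in this order.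
-/

open MeasureTheory Finset Filter Topology
open scoped ENNReal

namespace WNN

/-! ### Traces of a family of sets on blocks of points -/

/-- Permuting the coordinates of independent identically distributed points preserves their joint
distribution. -/
lemma measurePreserving_comp_perm {X α : Type*} [MeasurableSpace X] [Fintype α] (μ : Measure X)
    [IsProbabilityMeasure μ] (σ : Equiv.Perm α) :
    MeasurePreserving (fun z : α → X => z ∘ σ) (Measure.pi fun _ => μ) (Measure.pi fun _ => μ) := by
  convert measurePreserving_arrowCongr' (fun _ : α => μ) (fun _ : α => μ) σ.symm
    (MeasurableEquiv.refl X) (fun _ => MeasurePreserving.id μ) using 1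
  rfl

open Classical in
/-- The set of indices of the points of `z` that lie in `E`. -/
noncomputable def trace {X α : Type*} [Fintype α] (E : Set X) (z : α → X) : Finset α :=
  {a | z a ∈ E}

lemma mem_trace {X α : Type*} [Fintype α] {E : Set X} {z : α → X} {a : α} :
    a ∈ trace E z ↔ z a ∈ E := by
  simp [trace]

lemma measurableSet_trace_eq {X α : Type*} [MeasurableSpace X] [Fintype α] {E : Set X}
    (hE : MeasurableSet E) (p : Finset α) : MeasurableSet {z : α → X | trace E z = p} := by
  have : {z : α → X | trace E z = p} = ⋂ a, {z | z a ∈ E ↔ a ∈ p} := by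
    ext z
    simp [Finset.ext_iff, mem_trace]
  rw [this]
  refine MeasurableSet.iInter fun a => ?_
  have hm : MeasurableSet {z : α → X | z a ∈ E} := measurable_pi_apply (X := fun _ => X) a hE
  by_cases ha : a ∈ p
  · simpa only [ha, iff_true] using hm
  · simp only [ha, iff_false]
    exact hm.compl

open Classical in
/-- The weighted number of traces of the sets `E v` on `z` that avoid `A`, where a trace `p` has
the weight `β ^ #p`. -/
noncomputable def traceWeight {X α V : Type*} [Fintype α] (E : V → Set X) (β : ℝ≥0∞)
    (A : Finset α) (z : α → X) : ℝ≥0∞ :=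
  ∑ p : Finset α with Disjoint p A, if ∃ v, trace (E v) z = p then β ^ #p else 0

lemma measurable_traceWeight {X α V : Type*} [MeasurableSpace X] [Fintype α] [Countable V]
    {E : V → Set X} (hE : ∀ v, MeasurableSet (E v)) (β : ℝ≥0∞) (A : Finset α) :
    Measurable (traceWeight E β A) := by
  unfold traceWeight
  refine Finset.measurable_fun_sum _ fun p _ => Measurable.ite ?_ measurable_const measurable_const
  have : {z : α → X | ∃ v, trace (E v) z = p} = ⋃ v, {z | trace (E v) z = p} := by ext; simp
  rw [this]
  exact MeasurableSet.iUnion fun v => measurableSet_trace_eq (hE v) p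

lemma le_traceWeight {X α V : Type*} [Fintype α] {E : V → Set X} {β : ℝ≥0∞}
    {A : Finset α} {z : α → X} {v : V} (hv : ∀ a ∈ A, z a ∉ E v) :
    β ^ #(trace (E v) z) ≤ traceWeight E β A z := by
  classical
  unfold traceWeight
  refine le_trans ?_ (Finset.single_le_sum (fun _ _ => zero_le) (a := trace (E v) z) ?_)
  · rw [if_pos ⟨v, rfl⟩]
  · simp only [mem_filter, mem_univ, true_and, Finset.disjoint_left, mem_trace]
    exact fun a ha haA => hv a haA ha

lemma traceWeight_comp_perm {X α V : Type*} [Fintype α] [DecidableEq α] (E : V → Set X) (β : ℝ≥0∞)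
    (A : Finset α) (z : α → X) (σ : Equiv.Perm α) :
    traceWeight E β A (z ∘ σ) = traceWeight E β (A.map σ.toEmbedding) z := by
  unfold traceWeight
  have key : ∀ (v : V), (trace (E v) (z ∘ σ)).map σ.toEmbedding = trace (E v) z := by
    intro v
    ext a
    simp only [Finset.mem_map, mem_trace, Function.comp_apply, Equiv.coe_toEmbedding]
    constructor
    · rintro ⟨b, hb, rfl⟩
      exact hb
    · intro ha
      exact ⟨σ.symm a, by simpa using ha, by simp⟩
  refine Finset.sum_bij' (fun p _ => p.map σ.toEmbedding) (fun p _ => p.map σ.symm.toEmbedding)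
    ?_ ?_ ?_ ?_ ?_
  · intro p hp
    simpa using hp
  · intro p hp
    simp only [mem_filter, mem_univ, true_and] at hp ⊢
    rw [← Finset.disjoint_map σ.toEmbedding]
    simpa [Finset.map_map, Equiv.symm_trans_self, ← Equiv.trans_toEmbedding] using hp
  · intro p _
    simp [Finset.map_map]
  · intro p _
    simp [Finset.map_map]
  · intro p _
    have : (∃ v, trace (E v) (z ∘ σ) = p) ↔ ∃ v, trace (E v) z = p.map σ.toEmbedding := by
      refine exists_congr fun v => ?_
      rw [← key v]
      exact (Finset.map_inj (f := σ.toEmbedding)).symm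
    rw [card_map]
    by_cases h : ∃ v, trace (E v) (z ∘ σ) = p
    · rw [if_pos h, if_pos (this.1 h)]
    · rw [if_neg h, if_neg (this.not.1 h)]

/-- One point of each of the blocks `{i} × Fin (c + 1)`, selected by `j`. -/
def selection {ι : Type*} [Fintype ι] {c : ℕ} (j : ι → Fin (c + 1)) : Finset (ι × Fin (c + 1)) :=
  {a | a.2 = j a.1}

lemma mem_selection {ι : Type*} [Fintype ι] {c : ℕ} {j : ι → Fin (c + 1)}
    {a : ι × Fin (c + 1)} : a ∈ selection j ↔ a.2 = j a.1 := by
  simp [selection]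

/-- The permutation that exchanges, in each block, the selected point with the one of index `0`. -/
def blockSwap {ι : Type*} {c : ℕ} (j : ι → Fin (c + 1)) : Equiv.Perm (ι × Fin (c + 1)) :=
  Equiv.prodShear (Equiv.refl ι) fun i => Equiv.swap 0 (j i)

lemma map_blockSwap_selection {ι : Type*} [Fintype ι] {c : ℕ} (j : ι → Fin (c + 1)) :
    (selection fun _ : ι => (0 : Fin (c + 1))).map (blockSwap j).toEmbedding = selection j := by
  ext a
  obtain ⟨i, k⟩ := a
  rw [mem_map_equiv, mem_selection, mem_selection]
  simp [blockSwap, Equiv.swap_apply_eq_iff]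

lemma lintegral_traceWeight_selection {X ι V : Type*} [MeasurableSpace X] [Fintype ι]
    [Countable V] (μ : Measure X) [IsProbabilityMeasure μ] {E : V → Set X}
    (hE : ∀ v, MeasurableSet (E v)) (β : ℝ≥0∞) {c : ℕ} (j : ι → Fin (c + 1)) :
    ∫⁻ z : ι × Fin (c + 1) → X, traceWeight E β (selection j) z ∂(Measure.pi fun _ => μ) =
      ∫⁻ z : ι × Fin (c + 1) → X, traceWeight E β (selection fun _ => 0) z
        ∂(Measure.pi fun _ => μ) := by
  classical
  rw [← (measurePreserving_comp_perm μ (blockSwap j)).lintegral_comp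
    (measurable_traceWeight hE β (selection fun _ => 0))]
  simp only [traceWeight_comp_perm, map_blockSwap_selection]

/-- An index set `p` that contains `k i` places of the `i`-th block is disjoint from
`∏ (c + 1 - k i)` of the `(c + 1) ^ #ι` selections. By Bernoulli's inequality, the weight
`((c + 1) / c) ^ #p` at most makes up for this. -/
lemma sum_disjoint_selection_le {ι : Type*} [Fintype ι] [DecidableEq ι] {c : ℕ} (hc : 0 < c)
    (p : Finset (ι × Fin (c + 1))) :
    (#{j : ι → Fin (c + 1) | Disjoint p (selection j)} : ℝ) * (((c : ℝ) + 1) / c) ^ #p ≤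
      ((c : ℝ) + 1) ^ Fintype.card ι := by
  have hc' : (0 : ℝ) < c := by exact_mod_cast hc
  let q : ι → Finset (Fin (c + 1)) := fun i => {k | (i, k) ∈ p}
  have h1 : ({j : ι → Fin (c + 1) | Disjoint p (selection j)} : Finset _) =
      Fintype.piFinset fun i => (q i)ᶜ := by
    ext j
    simp only [mem_filter, mem_univ, true_and, Fintype.mem_piFinset, mem_compl, q,
      Finset.disjoint_right, mem_selection]
    exact ⟨fun h i => h rfl, fun h a ha => by have := h a.1; rwa [← ha] at this⟩
  have h2 : #p = ∑ i, #(q i) := by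
    have : p = ((univ : Finset ι).sigma q).map (Equiv.sigmaEquivProd ι _).toEmbedding := by
      ext ⟨i, k⟩
      simp [q]
    conv_lhs => rw [this]
    rw [card_map, card_sigma]
  rw [h1, Fintype.card_piFinset, h2, ← Finset.prod_pow_eq_pow_sum, Nat.cast_prod,
    ← Finset.prod_mul_distrib]
  refine (Finset.prod_le_prod (fun i _ => by positivity) (g := fun _ => (c : ℝ) + 1)
    fun i _ => ?_).trans (by simp)
  have hq : #(q i) ≤ c + 1 := by simpa using card_le_univ (q i)
  rw [card_compl, Fintype.card_fin, Nat.cast_sub hq]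
  have hb := one_add_mul_le_pow (a := -(1 / ((c : ℝ) + 1)))
    (by
      have : 1 / ((c : ℝ) + 1) ≤ 1 := by rw [div_le_one (by positivity)]; linarith
      linarith) (#(q i))
  have h3 : (1 + -(1 / ((c : ℝ) + 1))) = (((c : ℝ) + 1) / c)⁻¹ := by
    field_simp
    ring
  rw [h3, inv_pow] at hb
  have h4 : (0 : ℝ) < (((c : ℝ) + 1) / c) ^ #(q i) := by positivity
  have h5 : ((c + 1 : ℕ) : ℝ) - #(q i) = (c + 1) * (1 + #(q i) * -(1 / ((c : ℝ) + 1))) := by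
    push_cast
    field_simp
    ring
  rw [h5]
  calc _ ≤ (c + 1) * ((((c : ℝ) + 1) / c) ^ #(q i))⁻¹ * (((c : ℝ) + 1) / c) ^ #(q i) := by gcongr
    _ = c + 1 := by field_simp

lemma sum_traceWeight_selection_le {X ι V : Type*} [Fintype ι] [DecidableEq ι] (E : V → Set X)
    {c : ℕ} (hc : 0 < c) {K : ℕ} (z : ι × Fin (c + 1) → X)
    (hK : (Set.range fun v => trace (E v) z).ncard ≤ K) :
    ∑ j : ι → Fin (c + 1), traceWeight E (ENNReal.ofReal (((c : ℝ) + 1) / c)) (selection j) z ≤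
      ENNReal.ofReal (K * ((c : ℝ) + 1) ^ Fintype.card ι) := by
  classical
  unfold traceWeight
  simp_rw [Finset.sum_filter]
  rw [Finset.sum_comm]
  have h : ∀ p : Finset (ι × Fin (c + 1)),
      (∑ j : ι → Fin (c + 1), if Disjoint p (selection j) then
        (if ∃ v, trace (E v) z = p then ENNReal.ofReal (((c : ℝ) + 1) / c) ^ #p else 0) else 0) ≤
      if ∃ v, trace (E v) z = p then ENNReal.ofReal (((c : ℝ) + 1) ^ Fintype.card ι) else 0 := by
    intro p
    by_cases hp : ∃ v, trace (E v) z = p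
    · simp only [if_pos hp]
      rw [← Finset.sum_filter, Finset.sum_const, nsmul_eq_mul,
        ← ENNReal.ofReal_pow (by positivity), ← ENNReal.ofReal_natCast,
        ← ENNReal.ofReal_mul (by positivity)]
      refine ENNReal.ofReal_le_ofReal (le_trans (le_of_eq ?_) (sum_disjoint_selection_le hc p))
      congr!
    · simp only [if_neg hp, ite_self, Finset.sum_const_zero, le_refl]
  have hcard : #{p | ∃ v, trace (E v) z = p} ≤ K := by
    refine le_trans (le_of_eq ?_) hK
    rw [← Set.ncard_coe_finset]
    congr 1
    ext p
    simp
  calc _ ≤ ∑ p, if ∃ v, trace (E v) z = p then ENNReal.ofReal (((c : ℝ) + 1) ^ Fintype.card ι)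
        else 0 := 
      Finset.sum_le_sum fun p _ => (by congr! : _ = _).trans_le (h p)
    _ = #{p | ∃ v, trace (E v) z = p} * ENNReal.ofReal (((c : ℝ) + 1) ^ Fintype.card ι) := by
      rw [← Finset.sum_filter, Finset.sum_const, nsmul_eq_mul]
    _ ≤ K * ENNReal.ofReal (((c : ℝ) + 1) ^ Fintype.card ι) :=
      mul_le_mul_left (Nat.cast_le.2 hcard) _
    _ = _ := by rw [ENNReal.ofReal_mul (Nat.cast_nonneg K), ENNReal.ofReal_natCast]

lemma lintegral_traceWeight_le {X ι V : Type*} [MeasurableSpace X] [Fintype ι]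
    [Countable V] (μ : Measure X) [IsProbabilityMeasure μ] {E : V → Set X}
    (hE : ∀ v, MeasurableSet (E v)) {c : ℕ} (hc : 0 < c) {K : ℕ}
    (hK : ∀ z : ι × Fin (c + 1) → X, (Set.range fun v => trace (E v) z).ncard ≤ K) :
    ∫⁻ z : ι × Fin (c + 1) → X,
      traceWeight E (ENNReal.ofReal (((c : ℝ) + 1) / c)) (selection fun _ : ι => 0) z
        ∂(Measure.pi fun _ => μ) ≤ K := by
  classical
  set β := ENNReal.ofReal (((c : ℝ) + 1) / c)
  set I := ∫⁻ z : ι × Fin (c + 1) → X, traceWeight E β (selection fun _ : ι => 0) z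
    ∂(Measure.pi fun _ => μ)
  have h1 : ((c + 1 : ℕ) ^ Fintype.card ι : ℝ≥0∞) * I =
      ∫⁻ z : ι × Fin (c + 1) → X, ∑ j : ι → Fin (c + 1), traceWeight E β (selection j) z
        ∂(Measure.pi fun _ => μ) := by
    rw [lintegral_finsetSum _ fun j _ => measurable_traceWeight hE β _]
    simp only [lintegral_traceWeight_selection μ hE]
    simp [I]
  have h2 : ((c + 1 : ℕ) ^ Fintype.card ι : ℝ≥0∞) * I ≤
      ((c + 1 : ℕ) ^ Fintype.card ι : ℝ≥0∞) * K := by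
    rw [h1]
    refine (lintegral_mono fun z => sum_traceWeight_selection_le E hc z (hK z)).trans ?_
    rw [lintegral_const, measure_univ, mul_one, mul_comm (K : ℝ),
      ENNReal.ofReal_mul (by positivity), ENNReal.ofReal_natCast,
      ENNReal.ofReal_pow (by positivity)]
    refine le_of_eq ?_
    congr 2
    rw [← ENNReal.ofReal_natCast]
    push_cast
    rfl
  exact (ENNReal.mul_le_mul_iff_right (by simp) (by finiteness)).1 h2

/-! ### Simultaneous bounds by means of ghost points -/

lemma card_ne_zero_block (ι : Type*) [Fintype ι] (c : ℕ) :
    Fintype.card {a : ι × Fin (c + 1) // ¬ a.2 = 0} = c * Fintype.card ι := by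
  classical
  have e : {a : ι × Fin (c + 1) // ¬ a.2 = 0} ≃ ι × {k : Fin (c + 1) // ¬ k = 0} :=
    { toFun := fun a => (a.1.1, ⟨a.1.2, a.2⟩)
      invFun := fun b => ⟨(b.1, b.2.1), b.2.2⟩
      left_inv := fun _ => rfl
      right_inv := fun _ => rfl }
  rw [Fintype.card_congr e, Fintype.card_prod, Fintype.card_subtype_compl]
  simp [mul_comm]

/-- The moment generating function of the number of independent points that fall into `E`. -/
lemma lintegral_pow_card_trace {X κ : Type*} [MeasurableSpace X] [Fintype κ] (μ : Measure X)
    [IsProbabilityMeasure μ] {E : Set X} (hE : MeasurableSet E) {b : ℝ} (hb : 0 ≤ b) :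
    ∫⁻ g : κ → X, ENNReal.ofReal (1 + b) ^ #(trace E g) ∂(Measure.pi fun _ => μ) =
      ENNReal.ofReal ((1 + b * μ.real E) ^ Fintype.card κ) := by
  classical
  let f : X → ℝ≥0∞ := fun x => 1 + E.indicator (fun _ => ENNReal.ofReal b) x
  have hf : Measurable f := by fun_prop (disch := assumption)
  have h1 : ∀ g : κ → X, ENNReal.ofReal (1 + b) ^ #(trace E g) = ∏ k, f (g k) := by
    intro g
    have : ∀ k, f (g k) = if k ∈ trace E g then ENNReal.ofReal (1 + b) else 1 := by
      intro k
      by_cases hk : g k ∈ E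
      · simp [f, hk, mem_trace, ENNReal.ofReal_add zero_le_one hb]
      · simp [f, hk, mem_trace]
    simp only [this]
    rw [Finset.prod_ite_mem, univ_inter, prod_const]
  have h2 : ∫⁻ x, f x ∂μ = ENNReal.ofReal (1 + b * μ.real E) := by
    rw [lintegral_add_left measurable_const, lintegral_const, measure_univ, mul_one,
      lintegral_indicator_const hE, ENNReal.ofReal_add zero_le_one (by positivity),
      ENNReal.ofReal_mul hb, ENNReal.ofReal_one, ofReal_measureReal]
  simp only [h1]
  rw [ProbabilityTheory.lintegral_prod_eq_prod_lintegral_of_indepFun univ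
    (fun k (g : κ → X) => f (g k)) (ProbabilityTheory.iIndepFun_pi fun _ => hf.aemeasurable)
    (fun k => hf.comp (measurable_pi_apply k))]
  have h3 : ∀ k : κ, ∫⁻ g : κ → X, f (g k) ∂(Measure.pi fun _ => μ) = ∫⁻ x, f x ∂μ := fun k =>
    (measurePreserving_eval (fun _ : κ => μ) k).lintegral_comp hf
  simp only [h3, h2, prod_const, card_univ]
  rw [ENNReal.ofReal_pow (by positivity)]

/-- If the sets `E v` leave at most `K` different traces on any `(c + 1) * #ι` points, then the
probability that `#ι` random points avoid one of the sets of measure at least `ε` is at most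
`K * (1 + ε / c) ^ (-c * #ι)`. Here each of the points is joined by `c` ghost points: given that the
points avoid `E v`, the expectation of `((c + 1) / c) ^ k`, where `k` is the number of ghost points
in `E v`, is at least `(1 + ε / c) ^ (c * #ι)`. -/
lemma measure_exists_avoid_le {X ι V : Type*} [MeasurableSpace X] [Fintype ι]
    [Countable V] (μ : Measure X) [IsProbabilityMeasure μ] {E : V → Set X}
    (hE : ∀ v, MeasurableSet (E v)) {c : ℕ} (hc : 0 < c) {K : ℕ}
    (hK : ∀ z : ι × Fin (c + 1) → X, (Set.range fun v => trace (E v) z).ncard ≤ K)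
    {ε : ℝ} (hε : 0 ≤ ε) :
    Measure.pi (fun _ => μ) {y : ι → X | ∃ v, ε ≤ μ.real (E v) ∧ ∀ i, y i ∉ E v} ≤
      ENNReal.ofReal (K / (1 + ε / c) ^ (c * Fintype.card ι)) := by
  classical
  have hc' : (0 : ℝ) < c := by exact_mod_cast hc
  set β := ENNReal.ofReal (((c : ℝ) + 1) / c)
  have hβ : β = ENNReal.ofReal (1 + 1 / c) := by
    simp only [β]
    congr 1
    field_simp
  have hβ1 : 1 ≤ β := by
    rw [hβ, ← ENNReal.ofReal_one]
    exact ENNReal.ofReal_le_ofReal (by simp)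
  let p : ι × Fin (c + 1) → Prop := fun a => a.2 = 0
  let e := MeasurableEquiv.piEquivPiSubtypeProd (fun _ : ι × Fin (c + 1) => X) p
  let Φ : (ι × Fin (c + 1) → X) → ℝ≥0∞ := traceWeight E β (selection fun _ : ι => 0)
  have hΦ : Measurable Φ := measurable_traceWeight hE β _
  let Ψ : ({a // p a} → X) → ℝ≥0∞ := fun y =>
    ∫⁻ g : {a // ¬ p a} → X, Φ (e.symm (y, g)) ∂(Measure.pi fun _ => μ)
  have hΨ : Measurable Ψ := (hΦ.comp e.symm.measurable).lintegral_prod_right'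
  have hint : ∫⁻ y, Ψ y ∂(Measure.pi fun _ => μ) ≤ K := by
    refine le_trans (le_of_eq ?_) (lintegral_traceWeight_le μ hE hc hK)
    rw [← ((measurePreserving_piEquivPiSubtypeProd (fun _ : ι × Fin (c + 1) => μ) p).symm
      e).lintegral_comp hΦ]
    exact (lintegral_prod _ (hΦ.comp e.symm.measurable).aemeasurable).symm
  set q := (1 + ε / c) ^ (c * Fintype.card ι)
  have hq : 0 < q := by positivity
  have hlow : ∀ y : {a // p a} → X, (∃ v, ε ≤ μ.real (E v) ∧ ∀ a, y a ∉ E v) →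
      ENNReal.ofReal q ≤ Ψ y := by
    rintro y ⟨v, hv, hy⟩
    calc ENNReal.ofReal q ≤ ENNReal.ofReal ((1 + 1 / c * μ.real (E v)) ^
          Fintype.card {a : ι × Fin (c + 1) // ¬ p a}) := by
          rw [show Fintype.card {a : ι × Fin (c + 1) // ¬ p a} = c * Fintype.card ι from
            card_ne_zero_block ι c, one_div_mul_eq_div]
          exact ENNReal.ofReal_le_ofReal
            (pow_le_pow_left₀ (by positivity) (by gcongr) _)
      _ = ∫⁻ g : {a // ¬ p a} → X, β ^ #(trace (E v) g) ∂(Measure.pi fun _ => μ) := by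
          rw [hβ, lintegral_pow_card_trace μ (hE v) (by positivity)]
      _ ≤ Ψ y := by
          refine lintegral_mono fun g => ?_
          refine le_trans ?_ (le_traceWeight (v := v) ?_)
          · refine pow_le_pow_right₀ hβ1 (card_le_card_of_injOn Subtype.val ?_
              Subtype.val_injective.injOn)
            intro a ha
            have ha' := mem_trace.1 (mem_coe.1 ha)
            rw [mem_coe, mem_trace]
            simpa [e, MeasurableEquiv.piEquivPiSubtypeProd, Equiv.piEquivPiSubtypeProd, a.2]
              using ha'
          · intro a ha
            have ha' : p a := mem_selection.1 ha
            simpa [e, MeasurableEquiv.piEquivPiSubtypeProd, Equiv.piEquivPiSubtypeProd, ha']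
              using hy ⟨a, ha'⟩
  have hmarkov := (mul_meas_ge_le_lintegral (μ := Measure.pi fun _ : {a // p a} => μ) hΨ
    (ENNReal.ofReal q)).trans hint
  let s : ι ≃ {a : ι × Fin (c + 1) // p a} :=
    { toFun := fun i => ⟨(i, 0), rfl⟩
      invFun := fun a => a.1.1
      left_inv := fun _ => rfl
      right_inv := fun a => Subtype.ext (Prod.ext rfl a.2.symm) }
  have hs : MeasurePreserving (fun (y : ι → X) (a : {a // p a}) => y (s.symm a))
      (Measure.pi fun _ => μ) (Measure.pi fun _ => μ) := by
    convert measurePreserving_arrowCongr' (fun _ => μ) (fun _ => μ) s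
      (MeasurableEquiv.refl X) (fun _ => MeasurePreserving.id μ) using 1
    rfl
  have hsub : {y : ι → X | ∃ v, ε ≤ μ.real (E v) ∧ ∀ i, y i ∉ E v} ⊆
      (fun (y : ι → X) (a : {a // p a}) => y (s.symm a)) ⁻¹' {y | ENNReal.ofReal q ≤ Ψ y} := by
    rintro y ⟨v, hv, hy⟩
    exact hlow _ ⟨v, hv, fun a => hy _⟩
  refine (measure_mono hsub).trans ?_
  rw [hs.measure_preimage (measurableSet_le measurable_const hΨ).nullMeasurableSet,
    ENNReal.ofReal_div_of_pos hq, ENNReal.ofReal_natCast,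
    ENNReal.le_div_iff_mul_le (Or.inl (by simpa using hq)) (Or.inl ENNReal.ofReal_ne_top), mul_comm]
  exact hmarkov

/-! ### Minima of weighted tuples -/

/-- The first index at which the tuple `s` is minimal. -/
noncomputable def firstMin {m : ℕ} [NeZero m] (s : Fin m → ℝ) : Fin m :=
  ({j | ∀ k, s j ≤ s k} : Finset (Fin m)).min' <| by
    obtain ⟨j, -, hj⟩ := exists_min_image univ s univ_nonempty
    exact ⟨j, by simpa using hj⟩

lemma firstMin_le {m : ℕ} [NeZero m] (s : Fin m → ℝ) (k : Fin m) : s (firstMin s) ≤ s k := by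
  have : firstMin s ∈ ({j | ∀ k, s j ≤ s k} : Finset (Fin m)) := min'_mem _ _
  exact (mem_filter.1 this).2 k

lemma firstMin_le_of_forall_le {m : ℕ} [NeZero m] {s : Fin m → ℝ} {j : Fin m}
    (hj : ∀ k, s j ≤ s k) : firstMin s ≤ j :=
  min'_le _ _ (by simpa using hj)

lemma lt_of_lt_firstMin {m : ℕ} [NeZero m] {s : Fin m → ℝ} {k : Fin m} (hk : k < firstMin s) :
    s (firstMin s) < s k := by
  by_contra! h
  exact absurd (firstMin_le_of_forall_le fun i => h.trans (firstMin_le s i)) (not_le.2 hk)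

lemma firstMin_eq_iff {m : ℕ} [NeZero m] {s : Fin m → ℝ} {j : Fin m} :
    firstMin s = j ↔ (∀ k, s j ≤ s k) ∧ ∀ k < j, s j < s k := by
  constructor
  · rintro rfl
    exact ⟨firstMin_le s, fun k => lt_of_lt_firstMin⟩
  · rintro ⟨h1, h2⟩
    refine (firstMin_le_of_forall_le h1).eq_of_not_lt fun h => ?_
    exact absurd (h2 _ h) (not_lt.2 (firstMin_le s j))

lemma measurableSet_firstMin_eq {Ω : Type*} [MeasurableSpace Ω] {m : ℕ} [NeZero m]
    {s : Ω → Fin m → ℝ} (hs : ∀ k, Measurable fun ω => s ω k) (j : Fin m) :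
    MeasurableSet {ω | firstMin (s ω) = j} := by
  have : {ω | firstMin (s ω) = j} =
      (⋂ k, {ω | s ω j ≤ s ω k}) ∩ ⋂ k, ⋂ _ : k < j, {ω | s ω j < s ω k} := by
    ext ω
    simp [firstMin_eq_iff]
  rw [this]
  exact (MeasurableSet.iInter fun k => measurableSet_le (hs j) (hs k)).inter
    (MeasurableSet.iInter fun k => MeasurableSet.iInter fun _ => measurableSet_lt (hs j) (hs k))

lemma firstMin_mul_eq_of_zero {m : ℕ} [NeZero m] {d u v : Fin m → ℝ} (hd : ∀ k, 0 ≤ d k)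
    (hu : ∀ k, 0 < u k) (hv : ∀ k, 0 < v k) (h0 : ∃ k, d k = 0) :
    firstMin (fun k => d k * u k) = firstMin fun k => d k * v k := by
  obtain ⟨i, hi⟩ := h0
  have key : ∀ w : Fin m → ℝ, (∀ k, 0 < w k) → ∀ j,
      (∀ k, d j * w j ≤ d k * w k) ↔ d j = 0 := by
    intro w hw j
    constructor
    · intro h
      have h1 := h i
      rw [hi, zero_mul] at h1
      exact le_antisymm (nonpos_of_mul_nonpos_left h1 (hw j)) (hd j)
    · intro h k
      rw [h, zero_mul]
      exact mul_nonneg (hd k) (hw k).le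
  unfold firstMin
  simp only [key u hu, key v hv]

/-- An assignment of points to their nearest sites is determined by the number of points that each
site receives: among the assignments with these numbers it minimizes the product of the distances,
since the product of the weights is the same for all of them. -/
lemma firstMin_mul_eq_of_map_eq {α : Type*} [Fintype α] {m : ℕ} [NeZero m] {d : α → Fin m → ℝ}
    (hd : ∀ a k, 0 ≤ d a k) {u v : Fin m → ℝ} (hu : ∀ k, 0 < u k) (hv : ∀ k, 0 < v k)
    (h : (univ : Finset α).val.map (fun a => firstMin fun k => d a k * u k) =
      (univ : Finset α).val.map (fun a => firstMin fun k => d a k * v k)) (a : α) :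
    firstMin (fun k => d a k * u k) = firstMin fun k => d a k * v k := by
  classical
  set f : α → Fin m := fun a => firstMin fun k => d a k * u k with hf
  set g : α → Fin m := fun a => firstMin fun k => d a k * v k with hg
  -- Points at distance zero from a site are assigned regardless of the weights; for them all
  -- distances are replaced by `1`, which makes all the products positive.
  let e : α → Fin m → ℝ := fun a k => if ∃ j, d a j = 0 then 1 else d a k
  have hfg0 : ∀ a, (∃ j, d a j = 0) → f a = g a := fun a ha =>
    firstMin_mul_eq_of_zero (hd a) hu hv ha
  have he : ∀ a k, 0 < e a k := by
    intro a k
    by_cases ha : ∃ j, d a j = 0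
    · simp [e, ha]
    · simp only [e, ha, if_false]
      exact lt_of_le_of_ne (hd a k) fun h => ha ⟨k, h.symm⟩
  have hefu : ∀ a, e a (f a) * u (f a) ≤ e a (g a) * u (g a) := by
    intro a
    by_cases ha : ∃ j, d a j = 0
    · rw [hfg0 a ha]
    · simp only [e, ha, if_false]
      exact firstMin_le (fun k => d a k * u k) _
  have hegv : ∀ a, e a (g a) * v (g a) ≤ e a (f a) * v (f a) := by
    intro a
    by_cases ha : ∃ j, d a j = 0
    · rw [hfg0 a ha]
    · simp only [e, ha, if_false]
      exact firstMin_le (fun k => d a k * v k) _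
  have hprod : ∀ w : Fin m → ℝ, ∏ a, w (f a) = ∏ a, w (g a) := by
    intro w
    have := congrArg (fun s => (s.map w).prod) h
    simp only [Multiset.map_map] at this
    exact this
  have hle1 : ∏ a, e a (f a) ≤ ∏ a, e a (g a) := by
    have := Finset.prod_le_prod (s := univ) (fun a _ => (mul_pos (he a (f a)) (hu _)).le)
      fun a _ => hefu a
    rw [prod_mul_distrib, prod_mul_distrib, hprod u] at this
    exact le_of_mul_le_mul_right this (prod_pos fun a _ => hu _)
  have hle2 : ∏ a, e a (g a) ≤ ∏ a, e a (f a) := by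
    have := Finset.prod_le_prod (s := univ) (fun a _ => (mul_pos (he a (g a)) (hv _)).le)
      fun a _ => hegv a
    rw [prod_mul_distrib, prod_mul_distrib, hprod v] at this
    exact le_of_mul_le_mul_right this (prod_pos fun a _ => hv _)
  have heq := le_antisymm hle1 hle2
  by_cases ha : ∃ j, d a j = 0
  · exact hfg0 a ha
  have hu_eq : d a (f a) * u (f a) = d a (g a) * u (g a) := by
    by_contra hne
    have hlt : e a (f a) * u (f a) < e a (g a) * u (g a) :=
      lt_of_le_of_ne (hefu a) (by simpa only [e, ha, if_false] using hne)
    have := Finset.prod_lt_prod (s := univ) (fun a _ => mul_pos (he a (f a)) (hu _))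
      (fun a _ => hefu a) ⟨a, mem_univ a, hlt⟩
    rw [prod_mul_distrib, prod_mul_distrib, hprod u, heq] at this
    exact lt_irrefl _ this
  have hv_eq : d a (g a) * v (g a) = d a (f a) * v (f a) := by
    by_contra hne
    have hlt : e a (g a) * v (g a) < e a (f a) * v (f a) :=
      lt_of_le_of_ne (hegv a) (by simpa only [e, ha, if_false] using hne)
    have := Finset.prod_lt_prod (s := univ) (fun a _ => mul_pos (he a (g a)) (hv _))
      (fun a _ => hegv a) ⟨a, mem_univ a, hlt⟩
    rw [prod_mul_distrib, prod_mul_distrib, hprod v, heq] at this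
    exact lt_irrefl _ this
  apply le_antisymm
  · refine firstMin_le_of_forall_le (s := fun k => d a k * u k) fun k => ?_
    rw [← hu_eq]
    exact firstMin_le (fun k => d a k * u k) k
  · refine firstMin_le_of_forall_le (s := fun k => d a k * v k) fun k => ?_
    rw [← hv_eq]
    exact firstMin_le (fun k => d a k * v k) k

/-- Weights that approximate `v` from above, and are distorted in such a way that a tie for the
first place is eventually decided in favor of the smallest index, as `firstMin` does. -/
lemma exists_rat_tendsto_firstMin {m : ℕ} [NeZero m] {v : Fin m → ℝ} (hv : ∀ k, 0 < v k) :
    ∃ q : ℕ → Fin m → ℚ, (∀ N k, 0 < q N k) ∧ ∀ d : Fin m → ℝ, (∀ k, 0 ≤ d k) →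
      ∀ᶠ N in atTop, firstMin (fun k => d k * (q N k : ℝ)) = firstMin fun k => d k * v k := by
  have hq : ∀ (N : ℕ) (k : Fin m), ∃ q : ℚ,
      v k * (1 + (k : ℝ) * (1 / ((N : ℝ) + 1))) < q ∧
      (q : ℝ) < v k * (1 + ((k : ℝ) + 1) * (1 / ((N : ℝ) + 1))) := by
    intro N k
    refine exists_rat_btwn (mul_lt_mul_of_pos_left ?_ (hv k))
    have : (0 : ℝ) < 1 / ((N : ℝ) + 1) := by positivity
    linarith [mul_lt_mul_of_pos_right (lt_add_one (k : ℝ)) this]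
  choose q hq1 hq2 using hq
  have hq0 : ∀ N k, v k < q N k := fun N k => lt_of_le_of_lt
    (le_mul_of_one_le_right (hv k).le (le_add_of_nonneg_right (by positivity))) (hq1 N k)
  have hlim : ∀ k, Tendsto (fun N => (q N k : ℝ)) atTop (𝓝 (v k)) := by
    intro k
    have h : Tendsto (fun N : ℕ => v k * (1 + ((k : ℝ) + 1) * (1 / ((N : ℝ) + 1)))) atTop
        (𝓝 (v k)) := by
      have := ((tendsto_one_div_add_atTop_nhds_zero_nat (𝕜 := ℝ)).const_mul
        ((k : ℝ) + 1)).const_add 1 |>.const_mul (v k)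
      simpa using this
    exact tendsto_of_tendsto_of_tendsto_of_le_of_le tendsto_const_nhds h
      (fun N => (hq0 N k).le) fun N => (hq2 N k).le
  refine ⟨q, fun N k => by exact_mod_cast (hv k).trans (hq0 N k), fun d hd => ?_⟩
  set j := firstMin fun k => d k * v k
  have hstrict : ∀ k, d j * v j < d k * v k →
      ∀ᶠ N in atTop, d j * (q N j : ℝ) < d k * (q N k : ℝ) := fun k hk =>
    ((hlim j).const_mul (d j)).eventually_lt ((hlim k).const_mul (d k)) hk
  have hall : ∀ k, ∀ᶠ N in atTop, d j * (q N j : ℝ) ≤ d k * (q N k : ℝ) ∧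
      (k < j → d j * (q N j : ℝ) < d k * (q N k : ℝ)) := by
    intro k
    rcases (firstMin_le (fun k => d k * v k) k).lt_or_eq with hlt | heq
    · filter_upwards [hstrict k hlt] with N hN using ⟨hN.le, fun _ => hN⟩
    · have hjk : j ≤ k := not_lt.1 fun h => (lt_of_lt_firstMin h).ne heq
      refine Eventually.of_forall fun N => ⟨?_, fun h => absurd h (not_lt.2 hjk)⟩
      rcases hjk.eq_or_lt with rfl | hjk
      · exact le_rfl
      have hjk' : (j : ℝ) + 1 ≤ k := by exact_mod_cast hjk
      calc d j * (q N j : ℝ) ≤ d j * (v j * (1 + ((j : ℝ) + 1) * (1 / ((N : ℝ) + 1)))) :=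
            mul_le_mul_of_nonneg_left (hq2 N j).le (hd j)
        _ = d j * v j * (1 + ((j : ℝ) + 1) * (1 / ((N : ℝ) + 1))) := by ring
        _ ≤ d j * v j * (1 + (k : ℝ) * (1 / ((N : ℝ) + 1))) :=
            mul_le_mul_of_nonneg_left (by gcongr) (mul_nonneg (hd j) (hv j).le)
        _ = d k * v k * (1 + (k : ℝ) * (1 / ((N : ℝ) + 1))) := by rw [heq]
        _ = d k * (v k * (1 + (k : ℝ) * (1 / ((N : ℝ) + 1)))) := by ring
        _ ≤ d k * (q N k : ℝ) := mul_le_mul_of_nonneg_left (hq1 N k).le (hd k)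
  filter_upwards [eventually_all.2 hall] with N hN
  exact firstMin_eq_iff.2 ⟨fun k => (hN k).1, fun k => (hN k).2⟩

/-! ### Nearest neighbor classifiers of tuples, and conditioning on the sites -/

/-- The classifier that assigns to `x` the label of the site `t k` with the smallest value of
`dist (t k) x * v k`, and with the smallest `k` among these. The `v k` are the inverse weights. -/
noncomputable def tupleClassifier {X : Type*} [MetricSpace X] (l : X → ℤˣ) {m : ℕ} [NeZero m]
    (t : Fin m → X) (v : Fin m → ℝ) (x : X) : ℤˣ :=
  l (t (firstMin fun k => dist (t k) x * v k))

/-- A weighted nearest neighbor classifier is given by the enumeration of its sites in the order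
that decides ties. -/
lemma exists_classifier_eq_tupleClassifier {X : Type*} [MetricSpace X] (l : X → ℤˣ)
    (r : LinearOrder X) (T : Finset X) [NeZero #T] {w : X → ℝ} (hw : ∀ x, 0 < w x) :
    ∃ (t : Fin #T → X) (v : Fin #T → ℝ), Function.Injective t ∧ (∀ k, t k ∈ T) ∧ (∀ k, 0 < v k) ∧
      classifier l r T w = tupleClassifier l t v := by
  let t := T.orderEmbOfFin rfl
  refine ⟨t, fun k => (w (t k))⁻¹, t.injective, fun k => T.orderEmbOfFin_mem rfl k,
    fun k => inv_pos.2 (hw _), ?_⟩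
  funext x
  have hT : ∀ y ∈ T, ∃ k, t k = y := by
    intro y hy
    have : y ∈ Set.range t := by rw [T.range_orderEmbOfFin rfl]; exact hy
    exact this
  set s : Fin #T → ℝ := fun k => dist (t k) x * (w (t k))⁻¹
  have hs : ∀ k, weightedDist w (t k) x = s k * (w x)⁻¹ := by
    intro k
    simp only [weightedDist, s, div_eq_mul_inv, mul_inv, mul_assoc]
  have hmem : ∀ k, t k ∈ nearest T w x ↔ ∀ i, s k ≤ s i := by
    intro k
    simp only [nearest, mem_filter]
    constructor
    · rintro ⟨-, h⟩ i
      have := h (t i) (T.orderEmbOfFin_mem rfl i)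
      rw [hs, hs] at this
      exact le_of_mul_le_mul_right this (inv_pos.2 (hw x))
    · intro h
      refine ⟨T.orderEmbOfFin_mem rfl k, fun z hz => ?_⟩
      obtain ⟨i, rfl⟩ := hT z hz
      rw [hs, hs]
      exact mul_le_mul_of_nonneg_right (h i) (inv_pos.2 (hw x)).le
  have hj := (hmem (firstMin s)).2 (firstMin_le s)
  have hne : (nearest T w x).Nonempty := ⟨_, hj⟩
  rw [classifier, dif_pos hne]
  refine congrArg l (le_antisymm (min'_le _ _ hj) (le_min' _ _ _ fun y hy => ?_))
  obtain ⟨k, rfl⟩ := hT y (mem_filter.1 hy).1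
  exact t.monotone (firstMin_le_of_forall_le ((hmem k).1 hy))

lemma measurableSet_label_ne {Ω : Type*} [MeasurableSpace Ω] {f g : Ω → ℤˣ} (hf : Measurable f)
    (hg : Measurable g) : MeasurableSet {ω | f ω ≠ g ω} := by
  have hval : Measurable (Units.val : ℤˣ → ℤ) := comap_measurable _
  have : {ω | f ω ≠ g ω} = {ω | (f ω : ℤ) = (g ω : ℤ)}ᶜ := by
    ext ω
    simp [Units.ext_iff]
  rw [this]
  exact (measurableSet_eq_fun (hval.comp hf) (hval.comp hg)).compl

lemma measurable_tupleClassifier {X Ω : Type*} [MetricSpace X] [MeasurableSpace X]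
    [MeasurableSpace Ω] (hdist : Measurable fun p : X × X => dist p.1 p.2) {l : X → ℤˣ}
    (hl : Measurable l) {m : ℕ} [NeZero m] {t : Ω → Fin m → X} (ht : Measurable t)
    {x : Ω → X} (hx : Measurable x) (v : Fin m → ℝ) :
    Measurable fun ω => tupleClassifier l (t ω) v (x ω) := by
  have htk : ∀ k, Measurable fun ω => t ω k := fun k => (measurable_pi_apply k).comp ht
  have hfm : Measurable fun ω => firstMin fun k => dist (t ω k) (x ω) * v k := by
    refine measurable_to_countable' fun j => ?_
    exact measurableSet_firstMin_eq (s := fun ω k => dist (t ω k) (x ω) * v k)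
      (fun k => (hdist.comp ((htk k).prodMk hx)).mul_const (v k)) j
  have : Measurable fun p : Fin m × Ω => l (t p.2 p.1) :=
    measurable_from_prod_countable_right fun k => hl.comp (htk k)
  exact this.comp (hfm.prodMk measurable_id)

lemma ncard_range_trace_le {X V α : Type*} [MetricSpace X] [Fintype α] (l : X → ℤˣ) {m : ℕ}
    [NeZero m] (t : Fin m → X) (u : V → Fin m → ℝ) (hu : ∀ v k, 0 < u v k) (z : α → X) :
    (Set.range fun v => trace {x | tupleClassifier l t (u v) x ≠ l x} z).ncard ≤
      (m + Fintype.card α - 1).choose (Fintype.card α) := by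
  classical
  let g : V → Finset α := fun v => trace {x | tupleClassifier l t (u v) x ≠ l x} z
  let s : V → Sym (Fin m) (Fintype.card α) := fun v =>
    ⟨(univ : Finset α).val.map fun a => firstMin fun k => dist (t k) (z a) * u v k, by simp⟩
  have hfac : g.FactorsThrough s := by
    intro v v' h
    have h' := firstMin_mul_eq_of_map_eq (d := fun a k => dist (t k) (z a))
      (fun a k => dist_nonneg) (hu v) (hu v') (congrArg Subtype.val h)
    ext a
    simp only [g, mem_trace, Set.mem_ofPred_eq, tupleClassifier, h' a]
  have hsub : Set.range g ⊆ Set.range (Function.extend s g fun _ => ∅) := by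
    rintro _ ⟨v, rfl⟩
    exact ⟨s v, hfac.extend_apply _ v⟩
  calc (Set.range g).ncard ≤ (Set.range (Function.extend s g fun _ => ∅)).ncard :=
        Set.ncard_le_ncard hsub (Set.finite_range _)
    _ ≤ Nat.card (Sym (Fin m) (Fintype.card α)) := by
        rw [← Set.image_univ, ← Set.ncard_univ]
        exact Set.ncard_image_le Set.finite_univ
    _ = _ := by
        rw [Nat.card_eq_fintype_card, Sym.card_sym_eq_choose, Fintype.card_fin]

/-- The classifier with weights `v` is the pointwise limit of classifiers with rational weights, so
that it may be replaced by one of them wherever finitely many points and the error matter. -/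
lemma exists_rat_tupleClassifier {X ι : Type*} [MetricSpace X] [MeasurableSpace X] [Finite ι]
    (hdist : Measurable fun p : X × X => dist p.1 p.2) (μ : Measure X) [IsProbabilityMeasure μ]
    {l : X → ℤˣ} (hl : Measurable l) {m : ℕ} [NeZero m] (t : Fin m → X) {v : Fin m → ℝ}
    (hv : ∀ k, 0 < v k) {ε : ℝ} (hε : ε < err μ l (tupleClassifier l t v)) (x : ι → X)
    (hx : ∀ i, tupleClassifier l t v (x i) = l (x i)) :
    ∃ q : Fin m → ℚ, (∀ k, 0 < q k) ∧ ε < err μ l (tupleClassifier l t fun k => (q k : ℝ)) ∧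
      ∀ i, tupleClassifier l t (fun k => (q k : ℝ)) (x i) = l (x i) := by
  obtain ⟨q, hq0, hq⟩ := exists_rat_tendsto_firstMin hv
  have heq : ∀ y, ∀ᶠ N in atTop,
      tupleClassifier l t (fun k => (q N k : ℝ)) y = tupleClassifier l t v y := by
    intro y
    filter_upwards [hq (fun k => dist (t k) y) fun k => dist_nonneg] with N hN
    simp only [tupleClassifier, hN]
  have hlim : Tendsto (fun N => μ {y | tupleClassifier l t (fun k => (q N k : ℝ)) y ≠ l y}) atTop
      (𝓝 (μ {y | tupleClassifier l t v y ≠ l y})) := by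
    refine tendsto_measure_of_tendsto_indicator_of_isFiniteMeasure atTop μ (fun N =>
      measurableSet_label_ne (measurable_tupleClassifier hdist hl measurable_const measurable_id _)
        hl) fun y => ?_
    filter_upwards [heq y] with N hN
    simp only [hN]
  have herr : ∀ᶠ N in atTop, ε < err μ l (tupleClassifier l t fun k => (q N k : ℝ)) :=
    ((ENNReal.tendsto_toReal (measure_ne_top μ _)).comp hlim).eventually_const_lt hε
  obtain ⟨N, hN1, hN2⟩ := (herr.and (eventually_all.2 fun i => heq (x i))).exists
  exact ⟨q N, hq0 N, hN1, fun i => (hN2 i).trans (hx i)⟩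

/-- Conditioning on the points with index in `J`. The classifiers `h v` depend on these points
only; so if, for any fixed value of them, it has probability at most `b` that the other points
avoid one of the sets `E v` of measure above `ε`, then the same bound holds for the whole sample. -/
lemma measure_exists_avoid_compl_le {X V : Type*} [MeasurableSpace X] [Countable V] {n : ℕ}
    (μ : Measure X) [IsProbabilityMeasure μ] (J : Fin n → Prop) [DecidablePred J]
    {E : V → ({j // J j} → X) → Set X}
    (hE : ∀ v, MeasurableSet {p : ({j // J j} → X) × X | p.2 ∈ E v p.1}) (ε : ℝ) {b : ℝ≥0∞}
    (hb : ∀ t, Measure.pi (fun _ => μ)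
      {y : {j // ¬ J j} → X | ∃ v, ε < μ.real (E v t) ∧ ∀ j, y j ∉ E v t} ≤ b) :
    Measure.pi (fun _ => μ) {x : Fin n → X | ∃ v, ε < μ.real (E v fun j => x j) ∧
      ∀ j, ¬ J j → x j ∉ E v fun j => x j} ≤ b := by
  let e := MeasurableEquiv.piEquivPiSubtypeProd (fun _ : Fin n => X) J
  let S : Set (({j // J j} → X) × ({j // ¬ J j} → X)) :=
    ⋃ v, ({p | ε < μ.real (E v p.1)} ∩ ⋂ j, {p | p.2 j ∉ E v p.1})
  have hS : MeasurableSet S := by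
    refine MeasurableSet.iUnion fun v => MeasurableSet.inter ?_ (MeasurableSet.iInter fun j => ?_)
    · have h : Measurable fun t : {j // J j} → X => μ.real (E v t) :=
        (measurable_measure_prodMk_left (hE v)).ennreal_toReal
      exact measurableSet_lt measurable_const (h.comp measurable_fst)
    · have h : Measurable fun p : ({j // J j} → X) × ({j // ¬ J j} → X) => (p.1, p.2 j) :=
        measurable_fst.prodMk ((measurable_pi_apply j).comp measurable_snd)
      exact (h (hE v)).compl
  have hpre : {x : Fin n → X | ∃ v, ε < μ.real (E v fun j => x j) ∧
      ∀ j, ¬ J j → x j ∉ E v fun j => x j} = e ⁻¹' S := by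
    ext x
    simp only [S, e, Set.mem_ofPred_eq, Set.mem_preimage, Set.mem_iUnion, Set.mem_inter_iff,
      Set.mem_iInter, Subtype.forall]
    rfl
  rw [hpre, (measurePreserving_piEquivPiSubtypeProd (fun _ : Fin n => μ) J).measure_preimage
    hS.nullMeasurableSet, Measure.prod_apply hS]
  refine (lintegral_mono (g := fun _ => b) fun t => ?_).trans (by simp)
  refine le_trans (le_of_eq ?_) (hb t)
  congr 1
  ext y
  simp [S]

/-! ### Estimates for the union bounds -/

lemma log_div_eq {n : ℕ} (hn : 0 < n) {δ : ℝ} (hδ : 0 < δ) :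
    Real.log (n / δ) = Real.log n + -Real.log δ := by
  rw [Real.log_div (by positivity) hδ.ne']
  ring

/-- In the lower bound of `(1 + ε / c) ^ (c * N)` by an exponential, the loss `ε ^ 2 * N / (2 * c)`
in the exponent is at most `A / c`, where `A = ε * N / 2`. -/
lemma exp_le_one_add_div_pow {A : ℝ} (hA : 0 ≤ A) {N c : ℕ} (hN : 0 < N) (hc : 0 < c)
    (hε : 2 / (N : ℝ) * A ≤ 1) :
    Real.exp (2 * A - A / c) ≤ (1 + 2 / (N : ℝ) * A / c) ^ (c * N) := by
  have hN' : (0 : ℝ) < N := by exact_mod_cast hN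
  have hc' : (0 : ℝ) < c := by exact_mod_cast hc
  set ε := 2 / (N : ℝ) * A with hεdef
  have hε0 : 0 ≤ ε := by positivity
  have hNε : N * ε = 2 * A := by rw [hεdef]; field_simp
  rw [← Real.le_log_iff_exp_le (by positivity), Real.log_pow]
  have h := Real.le_log_one_add_of_nonneg (x := ε / c) (by positivity)
  have h1 : 2 * (ε / c) / (ε / c + 2) = 2 * ε / (ε + 2 * c) := by field_simp
  rw [h1] at h
  calc 2 * A - A / c = A * (2 - 1 / c) := by ring
    _ ≤ A * (4 * c / (1 + 2 * c)) := by
        refine mul_le_mul_of_nonneg_left ?_ hA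
        rw [le_div_iff₀ (by positivity)]
        have : (2 - 1 / (c : ℝ)) * (1 + 2 * c) = 4 * c - 1 / c := by field_simp; ring
        rw [this]
        have : 0 < 1 / (c : ℝ) := by positivity
        linarith
    _ ≤ A * (4 * c / (ε + 2 * c)) := by gcongr
    _ = c * (N * ε) * (2 / (ε + 2 * c)) := by rw [hNε]; ring
    _ = ((c * N : ℕ) : ℝ) * (2 * ε / (ε + 2 * c)) := by push_cast; ring
    _ ≤ _ := mul_le_mul_of_nonneg_left h (by positivity)

/-- The number of assignments of `(c + 1) * (n - m)` points to `m` sites. Splitting off the factor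
`(4 / e) ^ (m - 1)` leaves `y ^ k / k! ≤ exp y` with `y = (c + 1) * e / 4`, and `e / 4 ≤ 0.7`. -/
lemma choose_le_exp {n m c : ℕ} (hm : 1 ≤ m) (hmn : m < n) :
    ((m + (c + 1) * (n - m) - 1).choose ((c + 1) * (n - m)) : ℝ) ≤
      Real.exp ((m - 1) * Real.log n + (m - 1) * (2 * Real.log 2 - 1) + 0.7 * (c + 1)) := by
  obtain ⟨k, rfl⟩ : ∃ k, m = k + 1 := ⟨m - 1, by omega⟩
  have hn' : (0 : ℝ) < n := by exact_mod_cast (show 0 < n by omega)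
  have h0 : k + 1 + (c + 1) * (n - (k + 1)) - 1 = (c + 1) * (n - (k + 1)) + k := by omega
  have h1 : (c + 1) * (n - (k + 1)) + k ≤ (c + 1) * n := by
    obtain ⟨d, rfl⟩ : ∃ d, n = d + (k + 1) := ⟨n - (k + 1), by omega⟩
    rw [Nat.add_sub_cancel]
    nlinarith [Nat.zero_le (c * (k + 1))]
  rw [h0, Nat.choose_symm_add]
  have h2 : (4 : ℝ) * Real.exp (-1) = Real.exp (2 * Real.log 2 - 1) := by
    rw [sub_eq_add_neg, Real.exp_add, two_mul, Real.exp_add, Real.exp_log two_pos]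
    norm_num
  have h3 : Real.exp 1 / 4 ≤ 0.7 := by
    have := Real.exp_one_lt_d9
    norm_num at this ⊢
    linarith
  have h4 : ((c : ℝ) + 1) = 4 * Real.exp (-1) * ((c + 1) * (Real.exp 1 / 4)) := by
    rw [Real.exp_neg]
    field_simp
  calc (((c + 1) * (n - (k + 1)) + k).choose k : ℝ)
      ≤ (((c + 1) * n).choose k : ℕ) := by exact_mod_cast Nat.choose_le_choose k h1
    _ ≤ (((c + 1) * n : ℕ) : ℝ) ^ k / k.factorial := Nat.choose_le_pow_div k _
    _ = (n : ℝ) ^ k * (((4 : ℝ) * Real.exp (-1)) ^ k *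
          (((c + 1) * (Real.exp 1 / 4)) ^ k / k.factorial)) := by
        push_cast
        rw [mul_pow, mul_div_assoc', ← mul_pow (4 * Real.exp (-1)), ← h4]
        ring
    _ ≤ (n : ℝ) ^ k * (((4 : ℝ) * Real.exp (-1)) ^ k *
          Real.exp ((c + 1) * (Real.exp 1 / 4))) := by
        gcongr
        exact Real.pow_div_factorial_le_exp _ (by positivity) k
    _ ≤ (n : ℝ) ^ k * (((4 : ℝ) * Real.exp (-1)) ^ k * Real.exp (0.7 * (c + 1))) := by
        rw [mul_comm (0.7 : ℝ)]
        gcongr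
    _ = _ := by
        rw [h2, ← Real.exp_nat_mul]
        nth_rewrite 1 [← Real.exp_log hn']
        rw [← Real.exp_nat_mul, ← Real.exp_add, ← Real.exp_add]
        congr 1
        push_cast
        ring

/-- There are `n ^ m` tuples of `m` indices, and for each of them the number of traces on the blocks
of size `c + 1` is a binomial coefficient. With `c` of the order of `log (2 * n)`, the factor `2` in
front of the bound and the factor `2` in `log (2 * n)` make up for both. -/
lemma union_bound_weights {n m : ℕ} (hm : 1 ≤ m) (hmn : m < n) {δ : ℝ} (hδ0 : 0 < δ)
    (hδ1 : δ < 1) {ε : ℝ}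
    (hε : ε = 2 / ((n : ℝ) - m) * (m * Real.log (2 * n) + Real.log (n / δ))) (hε1 : ε < 1) :
    ∃ c : ℕ, 0 < c ∧ (n : ℝ) ^ m * (((m + (c + 1) * (n - m) - 1).choose ((c + 1) * (n - m)) : ℝ) /
      (1 + ε / c) ^ (c * (n - m))) ≤ δ / n := by
  have hn : 0 < n := by omega
  have hn' : (0 : ℝ) < n := by exact_mod_cast hn
  have hm' : (1 : ℝ) ≤ m := by exact_mod_cast hm
  have hN : ((n - m : ℕ) : ℝ) = n - m := Nat.cast_sub hmn.le
  have hN0 : 0 < n - m := by omega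
  have hl2 := Real.log_two_gt_d9
  have ha : 0 < -Real.log δ := by linarith [Real.log_neg hδ0 hδ1]
  have hy : Real.log (2 * n) = Real.log 2 + Real.log n := Real.log_mul two_ne_zero hn'.ne'
  have hpow : ∀ j : ℕ, 2 ^ j ≤ n → j * Real.log 2 ≤ Real.log n := by
    intro j hj
    rw [← Real.log_pow]
    exact Real.log_le_log (by positivity) (by exact_mod_cast hj)
  rw [log_div_eq hn hδ0] at hε
  set a := -Real.log δ
  set x := Real.log n
  set y := Real.log (2 * n)
  set A := m * y + (x + a) with hA
  have hx0 : 0 ≤ x := by simpa using hpow 0 (by omega)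
  have hA0 : 0 ≤ A := by
    have : 0 ≤ y := by linarith
    positivity
  rw [← hN] at hε
  have h2A : 2 * A < (n : ℝ) - 1 := by
    have h : 2 * A < (n - m : ℕ) := by
      have h1 : ((n - m : ℕ) : ℝ) * ε = 2 * A := by rw [hε]; field_simp
      have h2 : (0 : ℝ) < (n - m : ℕ) := by exact_mod_cast hN0
      nlinarith
    rw [hN] at h
    linarith
  have hAy : y + x ≤ A := by nlinarith
  -- `ε < 1` forces `8 ≤ n`; this is found by inserting lower bounds of `n` into `2 * A < n - 1`.
  have hx1 := hpow 1 (by omega)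
  have hn4 : 4 ≤ n := by
    have : (3 : ℝ) < n := by push_cast at hx1; linarith
    exact_mod_cast this
  have hx2 := hpow 2 (by omega)
  have hn8 : 8 ≤ n := by
    have : (7 : ℝ) < n := by push_cast at hx2; linarith
    exact_mod_cast this
  have hx3 := hpow 3 (by omega)
  have hy4 : 2.7 ≤ y := by push_cast at hx3; linarith
  have hc : 0 < ⌈y⌉₊ := Nat.ceil_pos.2 (by linarith)
  -- With this `c`, the loss `A / c` in the exponent is at most `m + 1 + a`, while `exp (0.7 * c)`,
  -- a factor in the bound of the number of traces, stays below a power of `n`.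
  refine ⟨⌈y⌉₊, hc, ?_⟩
  set c := ⌈y⌉₊
  have hc' : (1 : ℝ) ≤ c := by exact_mod_cast hc
  have hcy : y ≤ c := Nat.le_ceil y
  have hcy' : (c : ℝ) < y + 1 := Nat.ceil_lt_add_one (by linarith)
  have hAc : A / c ≤ m + 1 + a := by
    rw [div_le_iff₀ (by positivity)]
    nlinarith
  have hD := exp_le_one_add_div_pow hA0 hN0 hc (by rw [← hε]; exact hε1.le)
  rw [← hε] at hD
  have hC := choose_le_exp (c := c) hm hmn
  have hδn : δ / n = Real.exp (-a - x) := by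
    rw [Real.exp_sub, neg_neg, Real.exp_log hδ0, Real.exp_log hn']
  have hnm : (n : ℝ) ^ m = Real.exp (m * x) := by
    rw [Real.exp_nat_mul, Real.exp_log hn']
  calc _ ≤ Real.exp (m * x) * (Real.exp ((m - 1) * x + (m - 1) * (2 * Real.log 2 - 1) +
          0.7 * (c + 1)) / Real.exp (2 * A - A / c)) := by
        rw [hnm]
        gcongr
    _ = Real.exp (m * x + ((m - 1) * x + (m - 1) * (2 * Real.log 2 - 1) + 0.7 * (c + 1) -
          (2 * A - A / c))) := by rw [← Real.exp_sub, ← Real.exp_add]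
    _ ≤ δ / n := by
        rw [hδn, Real.exp_le_exp]
        have hmy : (m : ℝ) * y = m * Real.log 2 + m * x := by rw [hy]; ring
        rw [hmy] at hA
        nlinarith

/-- A bound for the number of multisets of `m` out of `n` elements, by means of
`m ^ m / m! ≤ e ^ m`. -/
lemma choose_multiset_le_exp {n m : ℕ} (hm : 1 ≤ m) (hn : 0 < n) :
    ((n + m - 1).choose m : ℝ) ≤ Real.exp (m * Real.log ((n + m) / m) + m) := by
  have hm' : (0 : ℝ) < m := by exact_mod_cast hm
  have hn' : (0 : ℝ) < n := by exact_mod_cast hn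
  calc ((n + m - 1).choose m : ℝ) ≤ ((n + m).choose m : ℕ) := by
        exact_mod_cast Nat.choose_le_choose m (by omega)
    _ ≤ ((n + m : ℕ) : ℝ) ^ m / m.factorial := Nat.choose_le_pow_div m _
    _ = (((n : ℝ) + m) / m) ^ m * ((m : ℝ) ^ m / m.factorial) := by
        push_cast
        rw [div_pow]
        field_simp
    _ ≤ (((n : ℝ) + m) / m) ^ m * Real.exp m := by
        gcongr
        exact Real.pow_div_factorial_le_exp _ hm'.le m
    _ = _ := by
        rw [Real.exp_add, Real.exp_nat_mul, Real.exp_log (by positivity)]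

/-- There are `((n + m - 1).choose m) ^ 2` pairs of multisets of `m` indices. The loss in the
exponent, which is due to the `2 * m` instead of `m` points that are set aside, is `ε * m ≤ m`;
it is compensated by the factor `2` in the logarithm, since `(n + m) / m` is much smaller than
`2 * n / m`. -/
lemma union_bound_reconstruction {n m : ℕ} (hm : 1 ≤ m) (hmn : m < n) {δ : ℝ} (hδ0 : 0 < δ)
    (hδ1 : δ < 1) {ε : ℝ}
    (hε : ε = 2 / ((n : ℝ) - m) * (m * Real.log (2 * Real.exp 1 * n / m) + Real.log (n / δ)))
    (hε1 : ε < 1) :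
    2 * m ≤ n ∧
      ((n + m - 1).choose m : ℝ) ^ 2 * Real.exp (-ε * ((n : ℝ) - 2 * m)) ≤ δ / n := by
  have hn : 0 < n := by omega
  have hn' : (0 : ℝ) < n := by exact_mod_cast hn
  have hm' : (0 : ℝ) < m := by exact_mod_cast hm
  have hmn' : (m : ℝ) < n := by exact_mod_cast hmn
  have hl2 := Real.log_two_gt_d9
  have ha : 0 < -Real.log δ := by linarith [Real.log_neg hδ0 hδ1]
  have hL : Real.log (2 * Real.exp 1 * n / m) = Real.log 2 + 1 + Real.log (n / m) := by
    rw [mul_div_assoc, Real.log_mul (by positivity) (by positivity),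
      Real.log_mul two_ne_zero (by positivity), Real.log_exp]
  have hx0 : 0 ≤ Real.log n := Real.log_nonneg (by exact_mod_cast hn)
  have hz0 : 0 ≤ Real.log ((n : ℝ) / m) := Real.log_nonneg (by rw [one_le_div hm']; exact hmn'.le)
  rw [log_div_eq hn hδ0, hL] at hε
  set a := -Real.log δ
  set x := Real.log n
  set z := Real.log ((n : ℝ) / m) with hz
  have hεN : ε * (n - m) = 2 * (m * (Real.log 2 + 1 + z) + (x + a)) := by
    have : (n : ℝ) - m ≠ 0 := by linarith
    rw [hε]
    field_simp
  have hlt : 2 * (m * (Real.log 2 + 1 + z) + (x + a)) < n - m := by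
    rw [← hεN]
    nlinarith
  -- `ε < 1` forces `6 * m ≤ n`; this is found by inserting a lower bound of `n / m` into `hlt`.
  have hn4 : 4 * (m : ℝ) ≤ n := by nlinarith
  have hz2 : 2 * Real.log 2 ≤ z := by
    have h := Real.log_pow 2 2
    push_cast at h
    rw [← h, hz]
    exact Real.log_le_log (by norm_num) (by rw [le_div_iff₀ hm']; linarith)
  have hn6 : 6 * (m : ℝ) ≤ n := by nlinarith
  refine ⟨by
    have : 2 * (m : ℝ) ≤ n := by linarith
    exact_mod_cast this, ?_⟩
  have hlog : Real.log (((n : ℝ) + m) / m) ≤ z + 1 / 6 := by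
    calc Real.log (((n : ℝ) + m) / m) ≤ Real.log (n / m * (7 / 6)) := by
          refine Real.log_le_log (by positivity) ?_
          rw [div_mul_eq_mul_div]
          gcongr
          linarith
      _ = z + Real.log (7 / 6) := Real.log_mul (by positivity) (by norm_num)
      _ ≤ z + 1 / 6 := by
          have := Real.log_le_sub_one_of_pos (x := 7 / 6) (by norm_num)
          linarith
  have hC := choose_multiset_le_exp hm hn
  have hδn : δ / n = Real.exp (-a - x) := by
    rw [Real.exp_sub, neg_neg, Real.exp_log hδ0, Real.exp_log hn']
  calc _ ≤ Real.exp (m * Real.log ((n + m) / m) + m) ^ 2 *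
        Real.exp (-ε * ((n : ℝ) - 2 * m)) := by gcongr
    _ = Real.exp (2 * (m * Real.log ((n + m) / m) + m) + -ε * ((n : ℝ) - 2 * m)) := by
        rw [← Real.exp_nat_mul, ← Real.exp_add]
        push_cast
        rfl
    _ ≤ δ / n := by
        rw [hδn, Real.exp_le_exp]
        have h1 : -ε * ((n : ℝ) - 2 * m) = -(ε * (n - m)) + ε * m := by ring
        have h2 : ε * m ≤ m := mul_le_of_le_one_left hm'.le hε1.le
        have h3 := mul_le_mul_of_nonneg_left hlog hm'.le
        have h4 : 0.69 * (m : ℝ) ≤ m * Real.log 2 := by nlinarith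
        rw [h1, hεN]
        nlinarith

/-! ### Probability of a large error -/

lemma err_le_one {X : Type*} [MeasurableSpace X] (μ : Measure X) [IsProbabilityMeasure μ]
    (l h : X → ℤˣ) : err μ l h ≤ 1 :=
  measureReal_le_one

/-- For fixed indices of the sites in the sample, the sites may be considered as fixed, and the
other `n - m` points as a sample that is independent of them. -/
lemma measure_consistent_tupleClassifier_le {X : Type*} [MetricSpace X] [MeasurableSpace X]
    (hdist : Measurable fun p : X × X => dist p.1 p.2) (μ : Measure X) [IsProbabilityMeasure μ]
    {l : X → ℤˣ} (hl : Measurable l) {n m : ℕ} [NeZero m] {i : Fin m → Fin n}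
    (hi : Function.Injective i) {ε : ℝ} (hε : 0 ≤ ε) {c : ℕ} (hc : 0 < c) :
    Measure.pi (fun _ => μ) {x : Fin n → X | ∃ v : Fin m → ℝ, (∀ k, 0 < v k) ∧
      Consistent l x (tupleClassifier l (x ∘ i) v) ∧ ε < err μ l (tupleClassifier l (x ∘ i) v)} ≤
      ENNReal.ofReal (((m + (c + 1) * (n - m) - 1).choose ((c + 1) * (n - m)) : ℕ) /
        (1 + ε / c) ^ (c * (n - m))) := by
  classical
  let J : Fin n → Prop := fun j => j ∈ Set.range i
  let V := {q : Fin m → ℚ // ∀ k, 0 < q k}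
  let u : V → Fin m → ℝ := fun q k => q.1 k
  have hu : ∀ v k, 0 < u v k := fun v k => Rat.cast_pos.2 (v.2 k)
  let s : ({j // J j} → X) → Fin m → X := fun t k => t ⟨i k, k, rfl⟩
  have hs : Measurable s := measurable_pi_lambda _ fun k => measurable_pi_apply _
  let E : V → ({j // J j} → X) → Set X := fun v t =>
    {z | tupleClassifier l (s t) (u v) z ≠ l z}
  have hE : ∀ v, MeasurableSet {p : ({j // J j} → X) × X | p.2 ∈ E v p.1} := fun v =>
    measurableSet_label_ne (measurable_tupleClassifier hdist hl (hs.comp measurable_fst)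
      measurable_snd (u v)) (hl.comp measurable_snd)
  have hcard : Fintype.card {j // ¬ J j} = n - m := by
    rw [Fintype.card_subtype_compl, Fintype.card_fin]
    congr 1
    rw [show Fintype.card {j // J j} = Fintype.card (Set.range i) from Fintype.card_congr
      (Equiv.refl _), Set.card_range_of_injective hi, Fintype.card_fin]
  refine le_trans (measure_mono ?_) (measure_exists_avoid_compl_le μ J hE ε fun t => ?_)
  · rintro x ⟨v, hv, hcons, herr⟩
    obtain ⟨q, hq0, hq1, hq2⟩ := exists_rat_tupleClassifier hdist μ hl (x ∘ i) hv herr x hcons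
    exact ⟨⟨q, hq0⟩, hq1, fun j _ => not_not.2 (hq2 j)⟩
  · have hEt : ∀ v, MeasurableSet (E v t) := fun v => measurable_prodMk_left (hE v)
    have h := measure_exists_avoid_le (ι := {j // ¬ J j}) μ hEt hc
      (K := (m + (c + 1) * (n - m) - 1).choose ((c + 1) * (n - m)))
      (fun z => by
        have h := ncard_range_trace_le l (s t) u hu z
        rwa [Fintype.card_prod, hcard, Fintype.card_fin, mul_comm (n - m)] at h) hε
    rw [hcard] at h
    refine (measure_mono ?_).trans h
    rintro y ⟨v, hv, hy⟩
    exact ⟨v, hv.le, hy⟩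

lemma measure_consistent_classifier_le {X : Type*} [MetricSpace X] [MeasurableSpace X]
    (hdist : Measurable fun p : X × X => dist p.1 p.2) (μ : Measure X) [IsProbabilityMeasure μ]
    {l : X → ℤˣ} (hl : Measurable l) {n m : ℕ} (hm : 1 ≤ m) (hmn : m < n) {δ : ℝ} (hδ0 : 0 < δ)
    (hδ1 : δ < 1) :
    Measure.pi (fun _ => μ) {x : Fin n → X | ∃ (r : LinearOrder X) (T : Finset X) (w : X → ℝ),
      #T = m ∧ (T : Set X) ⊆ Set.range x ∧ IsWeightAssignment T w ∧
      Consistent l x (classifier l r T w) ∧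
      2 / ((n : ℝ) - m) * (m * Real.log (2 * n) + Real.log (n / δ)) <
        err μ l (classifier l r T w)} ≤ ENNReal.ofReal (δ / n) := by
  classical
  set ε := 2 / ((n : ℝ) - m) * (m * Real.log (2 * n) + Real.log (n / δ)) with hεdef
  rcases le_or_gt 1 ε with hε1 | hε1
  · refine (measure_mono_null (t := ∅) ?_ measure_empty).trans_le zero_le
    rintro x ⟨r, T, w, -, -, -, -, h⟩
    exact absurd (hε1.trans_lt h) (not_lt.2 (err_le_one μ l _))
  have hn1 : (1 : ℝ) ≤ n := by exact_mod_cast (by omega : 1 ≤ n)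
  have hε0 : 0 ≤ ε := by
    have h1 : (0 : ℝ) < n - m := sub_pos.2 (by exact_mod_cast hmn)
    have h2 : 0 ≤ Real.log (2 * n) := Real.log_nonneg (by linarith)
    have h3 : 0 ≤ Real.log (n / δ) := Real.log_nonneg (by rw [one_le_div hδ0]; linarith)
    positivity
  have : NeZero m := ⟨by omega⟩
  obtain ⟨c, hc, hbound⟩ := union_bound_weights hm hmn hδ0 hδ1 hεdef hε1
  let B : {i : Fin m → Fin n // Function.Injective i} → Set (Fin n → X) := fun i =>
    {x | ∃ v : Fin m → ℝ, (∀ k, 0 < v k) ∧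
      Consistent l x (tupleClassifier l (x ∘ i.1) v) ∧ ε < err μ l (tupleClassifier l (x ∘ i.1) v)}
  calc _ ≤ Measure.pi (fun _ => μ) (⋃ i, B i) := measure_mono ?_
    _ ≤ ∑ i, Measure.pi (fun _ => μ) (B i) := measure_iUnion_fintype_le _ _
    _ ≤ ∑ i : {i : Fin m → Fin n // Function.Injective i}, ENNReal.ofReal
          (((m + (c + 1) * (n - m) - 1).choose ((c + 1) * (n - m)) : ℕ) /
          (1 + ε / c) ^ (c * (n - m))) :=
        Finset.sum_le_sum fun i _ => measure_consistent_tupleClassifier_le hdist μ hl i.2 hε0 hc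
    _ ≤ ((n ^ m : ℕ) : ℝ≥0∞) * ENNReal.ofReal
          (((m + (c + 1) * (n - m) - 1).choose ((c + 1) * (n - m)) : ℕ) /
          (1 + ε / c) ^ (c * (n - m))) := by
        rw [sum_const, nsmul_eq_mul, card_univ]
        refine mul_le_mul_left (Nat.cast_le.2 ?_) _
        simpa using Fintype.card_subtype_le fun i : Fin m → Fin n => Function.Injective i
    _ ≤ ENNReal.ofReal (δ / n) := by
        rw [← ENNReal.ofReal_natCast, ← ENNReal.ofReal_mul (by positivity), Nat.cast_pow]
        exact ENNReal.ofReal_le_ofReal hbound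
  rintro x ⟨r, T, w, rfl, hT, hw, hcons, herr⟩
  obtain ⟨t, v, htinj, htT, hv, heq⟩ := exists_classifier_eq_tupleClassifier l r T hw.1
  choose i hi using fun k => hT (htT k)
  have hxt : x ∘ i = t := funext hi
  rw [heq] at hcons herr
  refine Set.mem_iUnion.2 ⟨⟨i, fun a b hab => htinj ?_⟩, v, hv, ?_⟩
  · rw [← hi a, ← hi b, hab]
  · rw [hxt]
    exact ⟨hcons, herr⟩

/-- A monotone list is determined by the multiset of its entries. -/
lemma card_monotone_le (n m : ℕ) :
    Nat.card {i : Fin m → Fin n // Monotone i} ≤ (n + m - 1).choose m := by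
  let f : {i : Fin m → Fin n // Monotone i} → Sym (Fin n) m := fun i =>
    ⟨(List.ofFn i.1 : Multiset (Fin n)), by simp⟩
  have hf : Function.Injective f := by
    rintro ⟨i, hi⟩ ⟨j, hj⟩ h
    have hperm : (List.ofFn i).Perm (List.ofFn j) := Multiset.coe_eq_coe.1 (congrArg Subtype.val h)
    have hsorted := hperm.eq_of_sortedLE (List.sortedLE_ofFn_iff.2 hi) (List.sortedLE_ofFn_iff.2 hj)
    exact Subtype.ext (List.ofFn_injective hsorted)
  calc _ ≤ Nat.card (Sym (Fin n) m) := Nat.card_le_card_of_injective f hf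
    _ = _ := by rw [Nat.card_eq_fintype_card, Sym.card_sym_eq_choose, Fintype.card_fin]

lemma exists_monotone_of_reconstructs {X : Type*} {R : Reconstruction X}
    (hR : R.PermutationInvariant) {n m : ℕ} {l : X → ℤˣ} {x : Fin n → X} {h : X → ℤˣ}
    (hh : R.Reconstructs l x m h) :
    ∃ i j : Fin m → Fin n, Monotone i ∧ Monotone j ∧
      R m (fun k => (x (i k), l (x (i k)))) (fun k => (x (j k), l (x (j k)))) = h := by
  obtain ⟨s, t, hs, ht, rfl⟩ := hh
  choose i hi using hs
  choose j hj using ht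
  refine ⟨i ∘ Tuple.sort i, j ∘ Tuple.sort j, Tuple.monotone_sort i, Tuple.monotone_sort j, ?_⟩
  rw [← hR m s t (Tuple.sort i) (Tuple.sort j)]
  congr 1
  · funext k
    exact hi _
  · funext k
    exact hj _

/-- For fixed indices of the two lists, the lists may be considered as fixed, and the other points,
at least `n - 2 * m` of them, as a sample that is independent of them. -/
lemma measure_consistent_reconstruction_le {X : Type*} [MeasurableSpace X] (μ : Measure X)
    [IsProbabilityMeasure μ] {l : X → ℤˣ} (hl : Measurable l) {R : Reconstruction X}
    (hR : R.IsMeasurable) {n m : ℕ} (hmn : 2 * m ≤ n) (i j : Fin m → Fin n) {ε : ℝ} (hε : 0 ≤ ε) :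
    Measure.pi (fun _ => μ) {x : Fin n → X |
      Consistent l x (R m (fun k => (x (i k), l (x (i k)))) fun k => (x (j k), l (x (j k)))) ∧
      ε < err μ l (R m (fun k => (x (i k), l (x (i k)))) fun k => (x (j k), l (x (j k))))} ≤
      ENNReal.ofReal (Real.exp (-ε * ((n : ℝ) - 2 * m))) := by
  classical
  let J : Fin n → Prop := fun a => a ∈ univ.image i ∪ univ.image j
  have hJi : ∀ k, J (i k) := fun k => mem_union_left _ (mem_image_of_mem i (mem_univ k))
  have hJj : ∀ k, J (j k) := fun k => mem_union_right _ (mem_image_of_mem j (mem_univ k))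
  let s : ({a // J a} → X) → Fin m → X × ℤˣ := fun t k => (t ⟨i k, hJi k⟩, l (t ⟨i k, hJi k⟩))
  let s' : ({a // J a} → X) → Fin m → X × ℤˣ := fun t k => (t ⟨j k, hJj k⟩, l (t ⟨j k, hJj k⟩))
  have hs : Measurable s := measurable_pi_lambda _ fun k =>
    (measurable_pi_apply _).prodMk (hl.comp (measurable_pi_apply _))
  have hs' : Measurable s' := measurable_pi_lambda _ fun k =>
    (measurable_pi_apply _).prodMk (hl.comp (measurable_pi_apply _))
  let E : Unit → ({a // J a} → X) → Set X := fun _ t => {z | R m (s t) (s' t) z ≠ l z}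
  have hE : ∀ v, MeasurableSet {p : ({a // J a} → X) × X | p.2 ∈ E v p.1} := fun v =>
    measurableSet_label_ne ((hR m).comp ((hs.comp measurable_fst).prodMk
      ((hs'.comp measurable_fst).prodMk measurable_snd))) (hl.comp measurable_snd)
  have hcard : n - 2 * m ≤ Fintype.card {a // ¬ J a} := by
    rw [Fintype.card_subtype_compl, Fintype.card_fin, Fintype.card_coe]
    have h1 : #(univ.image i) ≤ m := card_image_le.trans (by simp)
    have h2 : #(univ.image j) ≤ m := card_image_le.trans (by simp)
    have h3 := card_union_le (univ.image i) (univ.image j)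
    omega
  refine le_trans (measure_mono ?_) (measure_exists_avoid_compl_le μ J hE ε fun t => ?_)
  · rintro x ⟨hcons, herr⟩
    exact ⟨(), herr, fun a _ => not_not.2 (hcons a)⟩
  · by_cases herr : ε < μ.real (E () t)
    · have hEt : MeasurableSet (E () t) := measurable_prodMk_left (hE ())
      have hcompl : μ (E () t)ᶜ ≤ ENNReal.ofReal (Real.exp (-ε)) := by
        rw [← ofReal_measureReal, probReal_compl_eq_one_sub hEt]
        refine ENNReal.ofReal_le_ofReal ?_
        linarith [Real.add_one_le_exp (-ε)]
      have hsub : {y : {a // ¬ J a} → X | ∃ v, ε < μ.real (E v t) ∧ ∀ a, y a ∉ E v t} ⊆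
          Set.univ.pi fun _ => (E () t)ᶜ := by
        rintro y ⟨_, _, hy⟩ a _
        exact hy a
      calc _ ≤ Measure.pi (fun _ => μ) (Set.univ.pi fun _ : {a // ¬ J a} => (E () t)ᶜ) :=
            measure_mono hsub
        _ = μ (E () t)ᶜ ^ Fintype.card {a // ¬ J a} := by
            rw [Measure.pi_pi, prod_const, card_univ]
        _ ≤ ENNReal.ofReal (Real.exp (-ε)) ^ Fintype.card {a // ¬ J a} := by gcongr
        _ = ENNReal.ofReal (Real.exp (Fintype.card {a // ¬ J a} * -ε)) := by
            rw [← ENNReal.ofReal_pow (Real.exp_nonneg _), ← Real.exp_nat_mul]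
        _ ≤ _ := by
            refine ENNReal.ofReal_le_ofReal (Real.exp_le_exp.2 ?_)
            have h1 : ((n - 2 * m : ℕ) : ℝ) ≤ Fintype.card {a // ¬ J a} := by exact_mod_cast hcard
            rw [Nat.cast_sub hmn] at h1
            push_cast at h1
            nlinarith
    · refine (measure_mono_null (t := ∅) ?_ measure_empty).trans_le zero_le
      rintro y ⟨_, h, _⟩
      exact absurd h herr

lemma measure_consistent_reconstructs_le {X : Type*} [MeasurableSpace X] (μ : Measure X)
    [IsProbabilityMeasure μ] {l : X → ℤˣ} (hl : Measurable l) {R : Reconstruction X}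
    (hR : R.IsMeasurable) (hRp : R.PermutationInvariant) {n m : ℕ} (hm : 1 ≤ m) (hmn : m < n)
    {δ : ℝ} (hδ0 : 0 < δ) (hδ1 : δ < 1) :
    Measure.pi (fun _ => μ) {x : Fin n → X | ∃ h, Consistent l x h ∧ R.Reconstructs l x m h ∧
      2 / ((n : ℝ) - m) * (m * Real.log (2 * Real.exp 1 * n / m) + Real.log (n / δ)) <
        err μ l h} ≤ ENNReal.ofReal (δ / n) := by
  classical
  set ε := 2 / ((n : ℝ) - m) * (m * Real.log (2 * Real.exp 1 * n / m) + Real.log (n / δ))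
    with hεdef
  rcases le_or_gt 1 ε with hε1 | hε1
  · refine (measure_mono_null (t := ∅) ?_ measure_empty).trans_le zero_le
    rintro x ⟨h, -, -, herr⟩
    exact absurd (hε1.trans_lt herr) (not_lt.2 (err_le_one μ l _))
  have hn1 : (1 : ℝ) ≤ n := by exact_mod_cast (by omega : 1 ≤ n)
  have hm' : (0 : ℝ) < m := by exact_mod_cast hm
  have hmn' : (m : ℝ) < n := by exact_mod_cast hmn
  have hε0 : 0 ≤ ε := by
    have h1 : (0 : ℝ) < n - m := sub_pos.2 hmn'
    have h2 : 0 ≤ Real.log (2 * Real.exp 1 * n / m) := by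
      refine Real.log_nonneg ?_
      rw [one_le_div hm']
      nlinarith [Real.add_one_le_exp 1]
    have h3 : 0 ≤ Real.log (n / δ) := Real.log_nonneg (by rw [one_le_div hδ0]; linarith)
    positivity
  obtain ⟨h2m, hbound⟩ := union_bound_reconstruction hm hmn hδ0 hδ1 hεdef hε1
  let I := {i : Fin m → Fin n // Monotone i}
  let B : I × I → Set (Fin n → X) := fun p => {x |
    Consistent l x (R m (fun k => (x (p.1.1 k), l (x (p.1.1 k))))
      fun k => (x (p.2.1 k), l (x (p.2.1 k)))) ∧
    ε < err μ l (R m (fun k => (x (p.1.1 k), l (x (p.1.1 k))))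
      fun k => (x (p.2.1 k), l (x (p.2.1 k))))}
  have hI : Fintype.card I ≤ (n + m - 1).choose m := by
    rw [← Nat.card_eq_fintype_card]
    exact card_monotone_le n m
  calc _ ≤ Measure.pi (fun _ => μ) (⋃ p, B p) := measure_mono ?_
    _ ≤ ∑ p, Measure.pi (fun _ => μ) (B p) := measure_iUnion_fintype_le _ _
    _ ≤ ∑ p : I × I, ENNReal.ofReal (Real.exp (-ε * ((n : ℝ) - 2 * m))) :=
        Finset.sum_le_sum fun p _ =>
          measure_consistent_reconstruction_le μ hl hR h2m p.1.1 p.2.1 hε0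
    _ ≤ (((n + m - 1).choose m ^ 2 : ℕ) : ℝ≥0∞) *
          ENNReal.ofReal (Real.exp (-ε * ((n : ℝ) - 2 * m))) := by
        rw [sum_const, nsmul_eq_mul, card_univ, Fintype.card_prod, ← sq]
        exact mul_le_mul_left (Nat.cast_le.2 (Nat.pow_le_pow_left hI 2)) _
    _ ≤ ENNReal.ofReal (δ / n) := by
        rw [← ENNReal.ofReal_natCast, ← ENNReal.ofReal_mul (by positivity), Nat.cast_pow]
        exact ENNReal.ofReal_le_ofReal hbound
  rintro x ⟨h, hcons, hrec, herr⟩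
  obtain ⟨i, j, hi, hj, rfl⟩ := exists_monotone_of_reconstructs hRp hrec
  exact Set.mem_iUnion.2 ⟨(⟨i, hi⟩, ⟨j, hj⟩), hcons, herr⟩

/-- The union bound over the sizes `m`. The events need not be measurable, so that the complement of
a measurable hull of their union is taken. -/
lemma exists_measurableSet_forall_notMem {Ω : Type*} [MeasurableSpace Ω] (P : Measure Ω)
    [IsProbabilityMeasure P] (n : ℕ) {δ : ℝ} (hδ : 0 < δ) (B : ℕ → Set Ω)
    (hB : ∀ m, 1 ≤ m → m < n → P (B m) ≤ ENNReal.ofReal (δ / n)) :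
    ∃ G : Set Ω, MeasurableSet G ∧ ENNReal.ofReal (1 - δ) ≤ P G ∧
      ∀ x ∈ G, ∀ m, 1 ≤ m → m < n → x ∉ B m := by
  let U := ⋃ m ∈ Finset.Ico 1 n, B m
  have hU : P U ≤ ENNReal.ofReal δ := by
    calc P U ≤ ∑ m ∈ Finset.Ico 1 n, P (B m) := measure_biUnion_finset_le _ _
      _ ≤ ∑ m ∈ Finset.Ico 1 n, ENNReal.ofReal (δ / n) := by
          refine Finset.sum_le_sum fun m hm => ?_
          rw [Finset.mem_Ico] at hm
          exact hB m hm.1 hm.2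
      _ = ENNReal.ofReal ((n - 1 : ℕ) * (δ / n)) := by
          rw [sum_const, Nat.card_Ico, nsmul_eq_mul, ← ENNReal.ofReal_natCast,
            ← ENNReal.ofReal_mul (by positivity)]
      _ ≤ ENNReal.ofReal δ := by
          refine ENNReal.ofReal_le_ofReal ?_
          rcases Nat.eq_zero_or_pos n with rfl | hn
          · simpa using hδ.le
          have hn' : (0 : ℝ) < n := by exact_mod_cast hn
          calc ((n - 1 : ℕ) : ℝ) * (δ / n) ≤ n * (δ / n) := by
                gcongr
                exact Nat.sub_le n 1
            _ = δ := by field_simp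
  refine ⟨(toMeasurable P U)ᶜ, (measurableSet_toMeasurable P U).compl, ?_, fun x hx m hm hmn hxm =>
    hx (subset_toMeasurable P U (Set.mem_biUnion (by simp [hm, hmn]) hxm))⟩
  rw [prob_compl_eq_one_sub (measurableSet_toMeasurable P U), measure_toMeasurable,
    ENNReal.ofReal_sub _ hδ.le, ENNReal.ofReal_one]
  exact tsub_le_tsub_left hU 1

end WNN

theorem mainTheorem2 {X : Type*} [MetricSpace X] [MeasurableSpace X]
    (hdist : Measurable fun p : X × X => dist p.1 p.2)
    (μ : MeasureTheory.Measure X) [MeasureTheory.IsProbabilityMeasure μ]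
    (l : X → ℤˣ) (hl : Measurable l) (n : ℕ) (δ : ℝ) (hδ0 : 0 < δ) (hδ1 : δ < 1) :
    (∃ G : Set (Fin n → X), MeasurableSet G ∧
      ENNReal.ofReal (1 - δ) ≤ MeasureTheory.Measure.pi (fun _ : Fin n => μ) G ∧
      ∀ x ∈ G, ∀ (r : LinearOrder X) (T : Finset X) (w : X → ℝ),
        T.Nonempty → (T : Set X) ⊆ Set.range x → T.card < n →
        WNN.IsWeightAssignment T w →
        WNN.Consistent l x (WNN.classifier l r T w) →
        WNN.err μ l (WNN.classifier l r T w) ≤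
          2 / ((n : ℝ) - T.card) *
            (T.card * Real.log (2 * n) + Real.log (n / δ))) ∧
    (∀ R : WNN.Reconstruction X, R.IsMeasurable → R.PermutationInvariant →
      ∃ G : Set (Fin n → X), MeasurableSet G ∧
        ENNReal.ofReal (1 - δ) ≤ MeasureTheory.Measure.pi (fun _ : Fin n => μ) G ∧
        ∀ x ∈ G, ∀ (r : LinearOrder X) (T : Finset X) (w : X → ℝ),
          T.Nonempty → (T : Set X) ⊆ Set.range x → T.card < n →
          WNN.IsWeightAssignment T w →
          WNN.Consistent l x (WNN.classifier l r T w) →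
          R.Reconstructs l x T.card (WNN.classifier l r T w) →
          WNN.err μ l (WNN.classifier l r T w) ≤
            2 / ((n : ℝ) - T.card) *
              (T.card * Real.log (2 * Real.exp 1 * n / T.card) + Real.log (n / δ))) := by

  constructor
  · obtain ⟨G, hG, hPG, hGB⟩ := WNN.exists_measurableSet_forall_notMem
      (MeasureTheory.Measure.pi fun _ : Fin n => μ) n hδ0 _
      fun m hm hmn => WNN.measure_consistent_classifier_le hdist μ hl hm hmn hδ0 hδ1
    refine ⟨G, hG, hPG, fun x hx r T w hT hTx hTn hw hcons => ?_⟩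
    by_contra! h
    exact hGB x hx T.card hT.card_pos hTn ⟨r, T, w, rfl, hTx, hw, hcons, h⟩
  · intro R hR hRp
    obtain ⟨G, hG, hPG, hGB⟩ := WNN.exists_measurableSet_forall_notMem
      (MeasureTheory.Measure.pi fun _ : Fin n => μ) n hδ0 _
      fun m hm hmn => WNN.measure_consistent_reconstructs_le μ hl hR hRp hm hmn hδ0 hδ1
    refine ⟨G, hG, hPG, fun x hx r T w hT hTx hTn hw hcons hrec => ?_⟩
    by_contra! h
    exact hGB x hx T.card hT.card_pos hTn ⟨_, hcons, hrec, h⟩
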